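/- Let $k\ge 2$, $n\ge 1$ and $0\le\gamma\le 1$. Samples $X_1,\dots,X_n$ are drawn independently from an unknown distribution $p$ on $[k]=\{1,\dots,k\}$, one for each of $n$ users. There is a public coin $U$, independent of the samples and seen by everyone. Depending on $U$, user $i$ chooses a (possibly randomized) channel $W_i$ in a given set $\mathcal W$ of channels from $[k]$ to a countable alphabet $\mathcal Y$, and sends $Y_i=W_i(X_i)$. A $\gamma$-manipulation attack observes $U$ and $Y^n=(Y_1,\dots,Y_n)$, chooses at most $\gamma n$ coordinates and changes them arbitrarily; the server receives the resulting $Z^n$ and, knowing $U$, applies a tester $\mathcal T$ with values in $\{\mathtt{yes},\mathtt{no}\}$. Such a scheme tests identity to $q$ with distance parameter $\alpha$ if, under every $\gamma$-manipulation attack, $\Pr_p[\mathcal T(Z^n)=\mathtt{yes}]>0.9$ when $p=q$ and $\Pr_p[\mathcal T(Z^n)=\mathtt{no}]>0.9$ for every $p$ with $d_{TV}(p,q)\ge\alpha$. The minimax risk $R_{\mathrm{IT}}(k,n,\gamma)$ is the infimum of all $\alpha>0$ such that, for every known distribution $q$ on $[k]$, there is such a scheme. Suppose that there are no information constraints, that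 is, $\mathcal W$ contains a channel that sends the sample as it is (under an injective encoding of $[k]$ in $\mathcal Y$); for instance, $\mathcal Y=[k]$ and $\mathcal W$ consists of the identity channel only, so that the server sees the raw samples, a $\gamma$ fraction of which are adversarially corrupted, or $\mathcal W$ is the set of all channels into an alphabet with at least $k$ letters. Then $$R_{\mathrm{IT}}(k,n,\gamma)=\Theta\left(\min\left\{1,\ \frac{k^{1/4}}{\sqrt n}+\gamma+\sqrt{\frac{k\gamma}{n}}+\sqrt[4]{\frac{k\gamma^2}{n}}\right\}\right),$$ that is, the risk lies between $c$ and $C$ times this minimum, where $c,C>0$ are universal constants (independent of $k$, $n$, $\gamma$, $\mathcal Y$ and $\mathcal W$). -/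

import Mathlib

open scoped ENNReal

noncomputable section

namespace RobustTesting

/-- Total variation distance between two distributions on `[k]`. -/
def dTV {k : ℕ} (p q : PMF (Fin k)) : ℝ :=
  (1 / 2) * ∑ x, |(p x).toReal - (q x).toReal|

/-- A channel from `[k]` to the message alphabet `𝒴`: `W x y` is the probability of sending the
message `y` when the sample is `x`. -/
abbrev Channel (k : ℕ) (𝒴 : Type) : Type := Fin k → PMF 𝒴

/-- The probability of the message vector `y` when the `n` users hold independent samples from `p`
and user `i` uses the channel `W i`. -/
def messageProb {k n : ℕ} {𝒴 : Type} (p : PMF (Fin k)) (W : Fin n → Channel k 𝒴)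
    (y : Fin n → 𝒴) : ℝ≥0∞ :=
  ∏ i, ∑ x, p x * W i x (y i)

/-- A public-coin non-interactive scheme for `n` users whose channels have to lie in `𝒲`, together
with the tester of the server. The public coin `u` is drawn from the probability space `(Ω, μ)`,
independently of the samples; user `i` applies the channel `W u i` to its sample, and the server,
who knows `u`, applies `T u` to the vector of messages it receives (`true` is "yes",
`false` is "no"). -/
structure Scheme (k n : ℕ) {𝒴 : Type} (𝒲 : Set (Channel k 𝒴)) where
  Ω : Type
  mΩ : MeasurableSpace Ω
  μ : MeasureTheory.Measure Ω
  isProb : MeasureTheory.IsProbabilityMeasure μ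
  W : Ω → Fin n → Channel k 𝒴
  W_mem : ∀ u i, W u i ∈ 𝒲
  measurable_W : ∀ i x y, Measurable fun u => W u i x y
  T : Ω → (Fin n → 𝒴) → Bool
  measurable_T : ∀ z, MeasurableSet {u | T u z = true}

variable {k n : ℕ} {𝒴 : Type} {𝒲 : Set (Channel k 𝒴)}

open Classical in
/-- `M` is a `γ`-manipulation attack on the scheme: having seen the public coin `u` and all the
messages `y`, the adversary chooses at most `γ n` coordinates and changes them arbitrarily. -/
def Scheme.IsAttack (S : Scheme k n 𝒲) (γ : ℝ)
    (M : S.Ω → (Fin n → 𝒴) → (Fin n → 𝒴)) : Prop :=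
  (∀ u y, (hammingDist (M u y) y : ℝ) ≤ γ * n) ∧
    ∀ y z, @MeasurableSet S.Ω S.mΩ {u | M u y = z}

/-- The probability that the server answers `b` under the attack `M`, when the samples are drawn
from `p`. -/
def Scheme.answerProb (S : Scheme k n 𝒲) (M : S.Ω → (Fin n → 𝒴) → (Fin n → 𝒴))
    (p : PMF (Fin k)) (b : Bool) : ℝ≥0∞ :=
  @MeasureTheory.lintegral S.Ω S.mΩ S.μ fun u =>
    ∑' y : Fin n → 𝒴, if S.T u (M u y) = b then messageProb p (S.W u) y else 0

/-- The scheme tests identity to `q` with distance parameter `α`, under every `γ`-manipulation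
attack, with success probability greater than `0.9`. -/
def Scheme.Tests (S : Scheme k n 𝒲) (γ α : ℝ) (q : PMF (Fin k)) : Prop :=
  ∀ M, S.IsAttack γ M →
    9 / 10 < S.answerProb M q true ∧
      ∀ p, α ≤ dTV p q → 9 / 10 < S.answerProb M p false

/-- The minimax risk of identity testing under `γ`-manipulation attacks, for `n` users whose
channels have to lie in `𝒲`. -/
def riskIT (k n : ℕ) {𝒴 : Type} (𝒲 : Set (Channel k 𝒴)) (γ : ℝ) : ℝ :=
  sInf {α : ℝ | 0 < α ∧ ∀ q : PMF (Fin k), ∃ S : Scheme k n 𝒲, S.Tests γ α q}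

/-- There is no information constraint: a user is allowed to send its sample as it is, i.e. under an
injective encoding of `[k]` as messages. This holds if `𝒲` is the set of all channels into an
alphabet with at least `k` letters, and also if `𝒴 = [k]` and `𝒲` consists of the identity channel
only, in which case the server sees the raw (corrupted) samples. -/
def AllowsRawSamples (𝒲 : Set (Channel k 𝒴)) : Prop :=
  ∃ e : Fin k ↪ 𝒴, (fun x => PMF.pure (e x)) ∈ 𝒲

/-- The rate of robust identity testing, with the cap `1` that every risk obeys. -/
def rateIT (k n : ℕ) (γ : ℝ) : ℝ :=
  min 1 ((k : ℝ) ^ (1 / 4 : ℝ) / √(n : ℝ) + γ + √(k * γ / n) + (k * γ ^ 2 / n) ^ (1 / 4 : ℝ))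

end RobustTesting

end

/-! Lower bound. If two samples differ in at most `γ n` places, an adversary can turn either into
the other, so the samples on which every attack leaves the answer "yes" and those on which every
attack leaves it "no" are more than `γ n` apart. A channel is a random map from letters to messages,
independent of the samples, and coordinatewise maps contract Hamming distance. Hence raw samples are
the best case for the server, and `Scheme.Tests.lower_bound` reduces everything to bounding `E_q F +
E_mix H` for functions with `F x + H x' ≤ 1` at nearby points. Here `q` is uniform on pairs of
letters and the alternatives are Paninski's perturbations with amplitude `a = 2 α`. Ingster's second
moment bound gives the sampling term `k^(1/4) / √n`. The other terms come from coupling `n` uniform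
samples with `n` samples of an alternative: the success probabilities cannot both be large if the
expected number of mismatches is small compared with `γ n` (`prob_add_prob_le_of_far`). A single
perturbation costs `α` per sample and gives `γ`. For the uniform mixture, the next sample is biased
only as far as the past reveals the sign of its pair. By total variation this costs of order `α² n /
k` per sample, by Hellinger distance `α² √(n / k)`, which gives `√(kγ/n)` and `(kγ²/n)^(1/4)`.

Upper bound. The public coin splits each letter into copies, so that `q ≤ 1 / (2 k)` on at most `3
k` letters. The statistic is a sum over letters of a convex function `f` of the count, with slopes
in `[0, 1]`, corrected by a linear term so that its mean is zero and stationary at `q`. Under `p`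
the mean is then a sum of Bregman errors, nonnegative by convexity, while the bounded slopes let
each corrupted sample move the statistic by at most 2. For `n ≤ k`, `f` counts repetitions; for `n ≥
k`, it is a hinge at the expected count, smoothed at scale `√(n / k)`. The mean is bounded below by
`sum_bregman_ge`, the variance above by `efron_stein`, and Chebyshev concludes. -/

noncomputable section

namespace RobustTesting

/-! ### Expectations under product weights, and Hamming distance. -/

section ProductExpectation

open Finset

/-- The expectation of `F` under the `n`-fold product of the weights `w`. -/
def prodE {A : Type*} [Fintype A] (w : A → ℝ) (n : ℕ) (F : (Fin n → A) → ℝ) : ℝ :=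
  ∑ x, (∏ i, w (x i)) * F x

section prodE

variable {A B : Type*} [Fintype A] [Fintype B] (w : A → ℝ)

theorem sum_fin_cons {M : Type*} [AddCommMonoid M] (n : ℕ) (F : (Fin (n + 1) → A) → M) :
    ∑ x, F x = ∑ a, ∑ x : Fin n → A, F (Fin.cons a x) := by
  rw [← Fintype.sum_prod_type']
  exact (Fintype.sum_equiv (Fin.consEquiv fun _ => A) _ _ fun _ => rfl).symm

theorem prodE_zero (F : (Fin 0 → A) → ℝ) : prodE w 0 F = F Fin.elim0 := by
  simp only [prodE, univ_unique, sum_singleton, univ_eq_empty, prod_empty, one_mul]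
  congr 1

theorem prodE_succ (n : ℕ) (F : (Fin (n + 1) → A) → ℝ) :
    prodE w (n + 1) F = ∑ a, w a * prodE w n fun x => F (Fin.cons a x) := by
  simp only [prodE, sum_fin_cons, Fin.prod_univ_succ, Fin.cons_zero, Fin.cons_succ, mul_sum,
    mul_assoc]

theorem prodE_map [DecidableEq B] (φ : A → B) (n : ℕ) (F : (Fin n → B) → ℝ) :
    prodE (fun b => ∑ a with φ a = b, w a) n F = prodE w n fun x => F fun i => φ (x i) := by
  induction n with
  | zero =>
    rw [prodE_zero, prodE_zero]
    congr 1
    exact Subsingleton.elim _ _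
  | succ n ih =>
    rw [prodE_succ, prodE_succ, ← sum_fiberwise univ φ]
    refine sum_congr rfl fun b _ => ?_
    rw [sum_mul]
    refine sum_congr rfl fun a ha => ?_
    rw [ih]
    simp only [mem_filter, mem_univ, true_and] at ha
    congr 2
    funext x
    congr 1
    funext i
    refine Fin.cases ?_ (fun j => ?_) i <;> simp [ha]

theorem prodE_add (n : ℕ) (F G : (Fin n → A) → ℝ) :
    prodE w n (fun x => F x + G x) = prodE w n F + prodE w n G := by
  simp only [prodE, mul_add, sum_add_distrib]

theorem prodE_const_mul (n : ℕ) (c : ℝ) (F : (Fin n → A) → ℝ) :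
    prodE w n (fun x => c * F x) = c * prodE w n F := by
  simp only [prodE, mul_sum]
  exact sum_congr rfl fun x _ => by ring

theorem prodE_sum {ι : Type*} (s : Finset ι) (n : ℕ) (F : ι → (Fin n → A) → ℝ) :
    prodE w n (fun x => ∑ i ∈ s, F i x) = ∑ i ∈ s, prodE w n (F i) := by
  simp only [prodE, mul_sum]
  exact sum_comm

theorem prodE_prod (n : ℕ) (g : A → ℝ) :
    prodE w n (fun x => ∏ i, g (x i)) = (∑ a, w a * g a) ^ n := by
  simp only [prodE, ← prod_mul_distrib]
  rw [← Fin.prod_const, ← Fintype.piFinset_univ, prod_univ_sum]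

variable {w}

theorem prodE_const (hw : ∑ a, w a = 1) (n : ℕ) (c : ℝ) : prodE w n (fun _ => c) = c := by
  have := prodE_prod w n (fun _ => (1 : ℝ))
  simp only [prod_const_one, mul_one, hw, one_pow] at this
  have h := prodE_const_mul w n c (fun _ => 1)
  rw [this] at h
  simpa using h

theorem prodE_mono (hw : ∀ a, 0 ≤ w a) {n : ℕ} {F G : (Fin n → A) → ℝ} (h : ∀ x, F x ≤ G x) :
    prodE w n F ≤ prodE w n G :=
  sum_le_sum fun x _ => mul_le_mul_of_nonneg_left (h x) (prod_nonneg fun _ _ => hw _)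

theorem prodE_nonneg (hw : ∀ a, 0 ≤ w a) {n : ℕ} {F : (Fin n → A) → ℝ} (h : ∀ x, 0 ≤ F x) :
    0 ≤ prodE w n F :=
  sum_nonneg fun x _ => mul_nonneg (prod_nonneg fun _ _ => hw _) (h x)

end prodE

theorem hammingDist_cons {A : Type*} [DecidableEq A] {n : ℕ} (a b : A) (x y : Fin n → A) :
    hammingDist (Fin.cons a x : Fin (n + 1) → A) (Fin.cons b y : Fin (n + 1) → A) =
      (if a = b then 0 else 1) + hammingDist x y := by
  unfold hammingDist
  rw [Finset.card_filter, Finset.card_filter, Fin.sum_univ_succ]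
  simp

theorem hammingDist_map_le {n : ℕ} {A B : Fin n → Type*} [∀ i, DecidableEq (A i)]
    [∀ i, DecidableEq (B i)] (φ : ∀ i, A i → B i) (x y : ∀ i, A i) :
    hammingDist (fun i => φ i (x i)) (fun i => φ i (y i)) ≤ hammingDist x y :=
  hammingDist_comp_le_hammingDist φ

end ProductExpectation

/-! ### Couplings of a product with a mixture of products, by duality. -/

section Transport

open Finset

section transport

variable {A Z : Type*} [Fintype A] [Fintype Z]

/-- Duality bound for one step of a coupling. -/
theorem transport_step [DecidableEq A] {q v f h : A → ℝ} {c l : ℝ} (hq : ∀ a, 0 ≤ q a)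
    (hq1 : ∑ a, q a = 1) (hv : ∀ a, 0 ≤ v a) (hl : 0 ≤ l)
    (H : ∀ x x', v x' * f x + h x' ≤ v x' * (c + if x = x' then 0 else l)) :
    (∑ a, v a) * ∑ a, q a * f a + ∑ a, h a ≤
      (∑ a, v a) * c + l * ((1 / 2) * ∑ a, |v a - (∑ b, v b) * q a|) := by
  have hne : (univ : Finset A).Nonempty := by
    by_contra hcon
    rw [not_nonempty_iff_eq_empty] at hcon
    simp [hcon] at hq1
  obtain ⟨x₀, -, hx₀⟩ := exists_max_image univ f hne
  set V := ∑ a, v a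
  have hV : 0 ≤ V := sum_nonneg fun a _ => hv a
  -- Truncating `f` from below at `max f - l` is free: the hypothesis at `x₀` already bounds `h`
  -- with this value. Now `g` is within `l / 2` of the constant `f x₀ - l / 2`, which integrates to
  -- zero against `V q - v`, so the total variation appears with the factor `l`.
  set g : A → ℝ := fun a => max (f a) (f x₀ - l)
  have hgf : ∀ a, f a ≤ g a := fun a => le_max_left _ _
  have hh : ∀ a, h a ≤ v a * c - v a * g a := by
    intro a
    have h1 := H a a
    have h2 := H x₀ a
    simp only [if_true, add_zero] at h1
    have h3 : (if x₀ = a then 0 else l) ≤ l := by split_ifs <;> linarith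
    have h4 := mul_le_mul_of_nonneg_left h3 (hv a)
    rcases max_cases (f a) (f x₀ - l) with ⟨e, _⟩ | ⟨e, _⟩ <;> simp only [g, e] <;> nlinarith
  have hgc : ∀ a, |g a - (f x₀ - l / 2)| ≤ l / 2 := by
    intro a
    have := hx₀ a (mem_univ a)
    rw [abs_le]
    constructor
    · have : f x₀ - l ≤ g a := le_max_right _ _
      linarith
    · have : g a ≤ f x₀ := max_le this (by linarith)
      linarith
  calc V * ∑ a, q a * f a + ∑ a, h a
      ≤ V * ∑ a, q a * g a + ∑ a, (v a * c - v a * g a) := by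
        refine add_le_add (mul_le_mul_of_nonneg_left ?_ hV) (sum_le_sum fun a _ => hh a)
        exact sum_le_sum fun a _ => mul_le_mul_of_nonneg_left (hgf a) (hq a)
    _ = V * c + ∑ a, (V * q a - v a) * (g a - (f x₀ - l / 2)) := by
        have e1 : ∑ a, (V * q a - v a) * (f x₀ - l / 2) = 0 := by
          rw [← sum_mul, sum_sub_distrib, ← mul_sum, hq1]
          simp [V]
        simp only [mul_sub (_ - _ : ℝ) (g _), sum_sub_distrib, e1]
        simp only [sub_mul, sum_sub_distrib, mul_sum, V, ← sum_mul, mul_assoc]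
        ring
    _ ≤ V * c + ∑ a, |v a - V * q a| * (l / 2) := by
        refine add_le_add le_rfl (sum_le_sum fun a _ => ?_)
        refine (le_abs_self _).trans ?_
        rw [abs_mul, abs_sub_comm]
        exact mul_le_mul_of_nonneg_left (hgc a) (abs_nonneg _)
    _ = _ := by rw [← sum_mul]; ring

/-- The cost of the coupling of the product of `n` copies of `q` with the mixture, with weights `w`,
of the products of `n` copies of `p z`, that matches one sample after the other as well as it can. -/
def transportCost (p : Z → A → ℝ) (q : A → ℝ) (w : Z → ℝ) (n : ℕ) : ℝ :=
  ∑ t ∈ range n, ∑ x : Fin t → A,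
    (1 / 2) * ∑ a, |∑ z, w z * (∏ i, p z (x i)) * (p z a - q a)|

theorem transportCost_succ (p : Z → A → ℝ) (q : A → ℝ) (w : Z → ℝ) (n : ℕ) :
    transportCost p q w (n + 1) =
      (1 / 2) * ∑ a, |∑ z, w z * (p z a - q a)| +
        ∑ b, transportCost p q (fun z => w z * p z b) n := by
  unfold transportCost
  rw [sum_range_succ', add_comm, sum_comm]
  congr 1
  · simp
  · refine sum_congr rfl fun t _ => ?_
    rw [sum_fin_cons]
    simp [Fin.prod_univ_succ, mul_assoc]

/-- The dual form of the sequential coupling, so that no coupling has to be built. The weights `w`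
are not normalized: after the first mixture sample `b` has been seen, the induction continues with
`w z * p z b`, the posterior times the probability of `b`, and no division occurs. -/
theorem transport_le [DecidableEq A] {p : Z → A → ℝ} {q : A → ℝ} {l : ℝ} (hq : ∀ a, 0 ≤ q a)
    (hq1 : ∑ a, q a = 1) (hp : ∀ z a, 0 ≤ p z a) (hp1 : ∀ z, ∑ a, p z a = 1) (hl : 0 ≤ l) (n : ℕ) :
    ∀ {w : Z → ℝ} {F H : (Fin n → A) → ℝ} {c : ℝ}, (∀ z, 0 ≤ w z) →
      (∀ x x', F x + H x' ≤ c + l * hammingDist x x') →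
      (∑ z, w z) * prodE q n F + ∑ z, w z * prodE (p z) n H ≤
        (∑ z, w z) * c + l * transportCost p q w n := by
  induction n with
  | zero =>
    intro w F H c hw h
    have := h Fin.elim0 Fin.elim0
    simp only [prodE_zero, transportCost, range_zero, sum_empty, mul_zero, add_zero, ← sum_mul,
      ← mul_add]
    refine mul_le_mul_of_nonneg_left ?_ (sum_nonneg fun z _ => hw z)
    simpa using this
  | succ n ih =>
    intro w F H c hw h
    have key : ∀ x x' : A, (∑ z, w z * p z x') * prodE q n (fun y => F (Fin.cons x y)) +
        (∑ z, w z * p z x' * prodE (p z) n (fun y => H (Fin.cons x' y)) -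
          l * transportCost p q (fun z => w z * p z x') n) ≤
        (∑ z, w z * p z x') * (c + if x = x' then 0 else l) := by
      intro x x'
      have := @ih (fun z => w z * p z x') (fun y => F (Fin.cons x y)) (fun y => H (Fin.cons x' y))
        (c + if x = x' then 0 else l) (fun z => mul_nonneg (hw z) (hp z x')) (by
          intro y y'
          refine (h _ _).trans (le_of_eq ?_)
          rw [hammingDist_cons]
          split_ifs <;> push_cast <;> ring)
      linarith
    have hs := transport_step hq hq1
      (fun a => sum_nonneg fun z _ => mul_nonneg (hw z) (hp z a)) hl key
    have hV : ∑ a, ∑ z, w z * p z a = ∑ z, w z := by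
      rw [sum_comm]
      simp [← mul_sum, hp1]
    rw [hV] at hs
    have e1 : prodE q (n + 1) F = ∑ a, q a * prodE q n (fun y => F (Fin.cons a y)) :=
      prodE_succ _ _ _
    have e2 : ∑ z, w z * prodE (p z) (n + 1) H =
        ∑ a, ∑ z, w z * p z a * prodE (p z) n (fun y => H (Fin.cons a y)) := by
      rw [sum_comm]
      refine sum_congr rfl fun z _ => ?_
      rw [prodE_succ, mul_sum]
      exact sum_congr rfl fun a _ => by ring
    have e3 : ∀ a, ∑ z, w z * (p z a - q a) = ∑ z, w z * p z a - (∑ z, w z) * q a := by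
      intro a
      rw [sum_mul, ← sum_sub_distrib]
      exact sum_congr rfl fun z _ => by ring
    rw [e1, e2, transportCost_succ]
    simp only [e3]
    rw [sum_sub_distrib, ← mul_sum] at hs
    linarith

/-- Two sets at Hamming distance more than `r` cannot have large probabilities, one under the
product of `q`, the other under a mixture of products. -/
theorem prob_add_prob_le_of_far [DecidableEq A] {p : Z → A → ℝ} {q : A → ℝ} {w : Z → ℝ}
    (hq : ∀ a, 0 ≤ q a) (hq1 : ∑ a, q a = 1) (hp : ∀ z a, 0 ≤ p z a) (hp1 : ∀ z, ∑ a, p z a = 1)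
    (hw : ∀ z, 0 ≤ w z) (hw1 : ∑ z, w z = 1) {n : ℕ} {r : ℝ} (hr : 0 < r)
    {F H : (Fin n → A) → ℝ} (hF : ∀ x, F x ≤ 1) (hH : ∀ x, H x ≤ 1)
    (hFH : ∀ x x', (hammingDist x x' : ℝ) ≤ r → F x + H x' ≤ 1) :
    prodE q n F + ∑ z, w z * prodE (p z) n H ≤ 1 + transportCost p q w n / r := by
  have := @transport_le A Z _ _ _ p q r⁻¹ hq hq1 hp hp1 (by positivity) n w F H 1 hw (by
    intro x x'
    by_cases hx : (hammingDist x x' : ℝ) ≤ r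
    · have := hFH x x' hx
      have : 0 ≤ r⁻¹ * (hammingDist x x' : ℝ) := by positivity
      linarith
    · push Not at hx
      have : 1 ≤ r⁻¹ * (hammingDist x x' : ℝ) := by
        rw [inv_mul_eq_div, one_le_div hr]
        exact hx.le
      linarith [hF x, hH x'])
  rw [hw1, one_mul, one_mul, inv_mul_eq_div] at this
  exact this

/-- Hybrid argument: exchange one factor at a time. -/
theorem sum_abs_prod_sub_le {p p' : A → ℝ} (hp : ∀ a, 0 ≤ p a) (hp1 : ∑ a, p a = 1)
    (hp' : ∀ a, 0 ≤ p' a) (hp1' : ∑ a, p' a = 1) (n : ℕ) :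
    ∑ x : Fin n → A, |∏ i, p (x i) - ∏ i, p' (x i)| ≤ n * ∑ a, |p a - p' a| := by
  have hone : ∀ n : ℕ, ∑ x : Fin n → A, ∏ i, p' (x i) = 1 := fun n => by
    have := prodE_const hp1' n 1
    simpa [prodE] using this
  induction n with
  | zero => simp
  | succ n ih =>
    rw [sum_fin_cons]
    have : ∀ a, ∀ x : Fin n → A, |∏ i, p ((Fin.cons a x : Fin (n + 1) → A) i) -
        ∏ i, p' ((Fin.cons a x : Fin (n + 1) → A) i)| ≤
        p a * |∏ i, p (x i) - ∏ i, p' (x i)| + |p a - p' a| * ∏ i, p' (x i) := by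
      intro a x
      simp only [Fin.prod_univ_succ, Fin.cons_zero, Fin.cons_succ]
      have hx : 0 ≤ ∏ i, p' (x i) := prod_nonneg fun _ _ => hp' _
      calc _ = |p a * (∏ i, p (x i) - ∏ i, p' (x i)) + (p a - p' a) * ∏ i, p' (x i)| := by
            congr 1; ring
        _ ≤ _ := by
            refine (abs_add_le _ _).trans (le_of_eq ?_)
            rw [abs_mul, abs_mul, abs_of_nonneg (hp a), abs_of_nonneg hx]
    refine (sum_le_sum fun a _ => sum_le_sum fun x _ => this a x).trans ?_
    simp only [sum_add_distrib, ← mul_sum, ← sum_mul, hp1, hone, one_mul]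
    push_cast
    linarith

/-- Hellinger affinities multiply, and Bernoulli's inequality gives `b ^ n ≥ 1 - n (1 - b)`, so
squared Hellinger distance grows at most linearly in `n`; Cauchy–Schwarz passes to the `ℓ¹`
distance. -/
theorem sum_abs_prod_sub_le_sqrt {p p' : A → ℝ} (hp : ∀ a, 0 ≤ p a) (hp1 : ∑ a, p a = 1)
    (hp' : ∀ a, 0 ≤ p' a) (hp1' : ∑ a, p' a = 1) (n : ℕ) :
    ∑ x : Fin n → A, |∏ i, p (x i) - ∏ i, p' (x i)| ≤
      2 * √(n * ∑ a, (√(p a) - √(p' a)) ^ 2) := by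
  have hone : ∀ p : A → ℝ, ∑ a, p a = 1 → ∑ x : Fin n → A, ∏ i, p (x i) = 1 := fun p h => by
    simpa [prodE] using prodE_const h n 1
  set P : (Fin n → A) → ℝ := fun x => ∏ i, p (x i) with hP
  set Q : (Fin n → A) → ℝ := fun x => ∏ i, p' (x i) with hQ
  have hP0 : ∀ x, 0 ≤ P x := fun x => prod_nonneg fun _ _ => hp _
  have hQ0 : ∀ x, 0 ≤ Q x := fun x => prod_nonneg fun _ _ => hp' _
  have hP1 : ∑ x, P x = 1 := hone p hp1
  have hQ1 : ∑ x, Q x = 1 := hone p' hp1'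
  set b := ∑ a, √(p a) * √(p' a) with hb
  have hb0 : 0 ≤ b := sum_nonneg fun a _ => by positivity
  have hsq : ∑ a, (√(p a) - √(p' a)) ^ 2 = 2 - 2 * b := by
    have : ∀ a, (√(p a) - √(p' a)) ^ 2 = p a + p' a - 2 * (√(p a) * √(p' a)) := fun a => by
      have h1 := Real.sq_sqrt (hp a)
      have h2 := Real.sq_sqrt (hp' a)
      nlinarith
    simp only [this, sum_sub_distrib, sum_add_distrib, ← mul_sum, hp1, hp1', hb]
    ring
  have hBC : ∑ x, √(P x) * √(Q x) = b ^ n := by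
    have h := prodE_prod (fun _ : A => (1 : ℝ)) n (fun a => √(p a) * √(p' a))
    simp only [prodE, prod_const_one, one_mul] at h
    rw [hb, ← h]
    refine sum_congr rfl fun x _ => ?_
    rw [hP, hQ, Real.sqrt_prod _ fun i _ => hp _, Real.sqrt_prod _ fun i _ => hp' _,
      prod_mul_distrib]
  have hbern : 1 - n * (1 - b) ≤ b ^ n := by
    have := one_add_mul_le_pow (show (-2 : ℝ) ≤ b - 1 by linarith) n
    have e : 1 + (b - 1) = b := by ring
    rw [e] at this
    linarith
  have hs1 : ∑ x, (√(P x) - √(Q x)) ^ 2 ≤ n * (2 - 2 * b) := by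
    have : ∀ x, (√(P x) - √(Q x)) ^ 2 = P x + Q x - 2 * (√(P x) * √(Q x)) := fun x => by
      have h1 := Real.sq_sqrt (hP0 x)
      have h2 := Real.sq_sqrt (hQ0 x)
      nlinarith
    simp only [this, sum_sub_distrib, sum_add_distrib, ← mul_sum, hP1, hQ1, hBC]
    linarith
  have hs2 : ∑ x, (√(P x) + √(Q x)) ^ 2 ≤ 4 := by
    have : ∀ x, (√(P x) + √(Q x)) ^ 2 ≤ 2 * P x + 2 * Q x := fun x => by
      have h1 := Real.sq_sqrt (hP0 x)
      have h2 := Real.sq_sqrt (hQ0 x)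
      nlinarith [sq_nonneg (√(P x) - √(Q x))]
    refine (sum_le_sum fun x _ => this x).trans ?_
    simp only [sum_add_distrib, ← mul_sum, hP1, hQ1]
    norm_num
  have habs : ∀ x, |P x - Q x| = |√(P x) - √(Q x)| * (√(P x) + √(Q x)) := fun x => by
    have h1 := Real.sq_sqrt (hP0 x)
    have h2 := Real.sq_sqrt (hQ0 x)
    have h3 : P x - Q x = (√(P x) - √(Q x)) * (√(P x) + √(Q x)) := by nlinarith
    rw [h3, abs_mul, abs_of_nonneg (show 0 ≤ √(P x) + √(Q x) by positivity)]
  have hcs := sum_mul_sq_le_sq_mul_sq univ (fun x => |√(P x) - √(Q x)|)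
    (fun x => √(P x) + √(Q x))
  simp only [sq_abs, ← habs] at hcs
  rw [hsq]
  have hn : 0 ≤ (n : ℝ) * (2 - 2 * b) := (sum_nonneg fun x _ => sq_nonneg _).trans hs1
  refine abs_le_of_sq_le_sq' ?_ (by positivity) |>.2
  rw [mul_pow, Real.sq_sqrt hn]
  have h4 : 0 ≤ ∑ x, (√(P x) + √(Q x)) ^ 2 := sum_nonneg fun x _ => sq_nonneg _
  nlinarith

end transport

end Transport

/-! ### Paninski's perturbations: transport cost and second moment. -/

section Paninski

open Finset

/-- The sign `±1` encoded by a Boolean. -/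
def boolSign (b : Bool) : ℝ := if b then 1 else -1

theorem boolSign_not (b : Bool) : boolSign (!b) = -boolSign b := by
  cases b <;> simp [boolSign]

theorem boolSign_mul_self (b : Bool) : boolSign b * boolSign b = 1 := by
  cases b <;> simp [boolSign]

theorem abs_boolSign (b : Bool) : |boolSign b| = 1 := by
  cases b <;> simp [boolSign]

section paninski

variable {P : Type*} [Fintype P]

/-- Paninski's perturbation of the uniform distribution on `P × Bool`: the two elements of each pair
have the probabilities `(1 ± a) / (2 |P|)`, in the order given by the signs `z`. -/
def paninski (a : ℝ) (z : P → Bool) (x : P × Bool) : ℝ :=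
  (1 + a * boolSign (z x.1) * boolSign x.2) / (2 * Fintype.card P)

theorem paninski_zero (z : P → Bool) (x : P × Bool) :
    paninski 0 z x = 1 / (2 * Fintype.card P) := by
  simp [paninski]

theorem paninski_nonneg {a : ℝ} (ha : 0 ≤ a) (ha1 : a ≤ 1) (z : P → Bool) (x : P × Bool) :
    0 ≤ paninski a z x := by
  unfold paninski
  refine div_nonneg ?_ (by positivity)
  cases z x.1 <;> cases x.2 <;> simp [boolSign] <;> linarith

theorem sum_paninski [Nonempty P] (a : ℝ) (z : P → Bool) : ∑ x, paninski a z x = 1 := by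
  have : (0 : ℝ) < Fintype.card P := by exact_mod_cast Fintype.card_pos
  simp only [paninski, Fintype.sum_prod_type, Fintype.sum_bool, boolSign, if_true]
  simp only [Bool.false_eq_true, if_false, ← add_div, ← sum_div]
  rw [div_eq_one_iff_eq (by positivity)]
  have : ∀ x : P, (1 + a * (if z x = true then (1 : ℝ) else -1) * 1 +
      (1 + a * (if z x = true then (1 : ℝ) else -1) * -1)) = 2 := fun x => by ring
  rw [sum_congr rfl fun x _ => this x]
  simp
  ring

theorem paninski_sub (a : ℝ) (z z' : P → Bool) (x : P × Bool) :
    paninski a z x - paninski 0 z' x =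
      a / (2 * Fintype.card P) * boolSign x.2 * boolSign (z x.1) := by
  simp only [paninski]
  ring

theorem sum_abs_paninski_sub [Nonempty P] {a : ℝ} (ha : 0 ≤ a) (z z' : P → Bool) :
    ∑ x, |paninski a z x - paninski 0 z' x| = a := by
  have : (0 : ℝ) < Fintype.card P := by exact_mod_cast Fintype.card_pos
  simp only [paninski_sub, abs_mul, abs_boolSign, mul_one]
  rw [abs_of_nonneg (by positivity)]
  simp
  field_simp

theorem sum_abs_paninski_flip [DecidableEq P] [Nonempty P] {a : ℝ} (ha : 0 ≤ a) (z : P → Bool)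
    (j : P) :
    ∑ x, |paninski a z x - paninski a (Function.update z j (!z j)) x| =
      2 * a / Fintype.card P := by
  have hm : (0 : ℝ) < Fintype.card P := by exact_mod_cast Fintype.card_pos
  rw [Fintype.sum_prod_type, sum_eq_single j]
  · have : ∀ b, |paninski a z (j, b) - paninski a (Function.update z j (!z j)) (j, b)| =
        a / Fintype.card P := by
      intro b
      have : paninski a z (j, b) - paninski a (Function.update z j (!z j)) (j, b) =
          a / Fintype.card P * boolSign (z j) * boolSign b := by
        simp only [paninski, Function.update_self, boolSign_not]
        field_simp
        ring
      rw [this, abs_mul, abs_mul, abs_boolSign, abs_boolSign, abs_of_nonneg (by positivity)]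
      ring
    simp only [this, Fintype.sum_bool]
    ring
  · intro j' _ hj'
    simp [paninski, Function.update_of_ne hj']
  · simp

theorem sqrt_sub_sqrt_sq_le {u : ℝ} (h : -1 ≤ u) (h' : u ≤ 1) :
    (√(1 + u) - √(1 - u)) ^ 2 ≤ 2 * u ^ 2 := by
  have h1 := Real.sq_sqrt (show 0 ≤ 1 + u by linarith)
  have h2 := Real.sq_sqrt (show 0 ≤ 1 - u by linarith)
  have h3 : 1 - u ^ 2 ≤ √(1 + u) * √(1 - u) := by
    rw [← Real.sqrt_mul (by linarith)]
    apply Real.le_sqrt_of_sq_le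
    nlinarith [mul_nonneg (show 0 ≤ 1 + u by linarith) (show 0 ≤ 1 - u by linarith), sq_nonneg u]
  nlinarith

theorem sum_sqrt_paninski_flip_le [DecidableEq P] [Nonempty P] {a : ℝ} (ha : 0 ≤ a) (ha1 : a ≤ 1)
    (z : P → Bool) (j : P) :
    ∑ x, (√(paninski a z x) - √(paninski a (Function.update z j (!z j)) x)) ^ 2 ≤
      2 * a ^ 2 / Fintype.card P := by
  have hm : (0 : ℝ) < Fintype.card P := by exact_mod_cast Fintype.card_pos
  rw [Fintype.sum_prod_type, sum_eq_single j]
  · have : ∀ b, (√(paninski a z (j, b)) -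
        √(paninski a (Function.update z j (!z j)) (j, b))) ^ 2 ≤ a ^ 2 / Fintype.card P := by
      intro b
      simp only [paninski, Function.update_self, boolSign_not]
      set u := a * boolSign (z j) * boolSign b with hu
      have hu2 : u ^ 2 = a ^ 2 := by
        rw [hu, mul_pow, mul_pow, sq (boolSign _), sq (boolSign b), boolSign_mul_self,
          boolSign_mul_self]
        ring
      have hub : |u| ≤ 1 := by
        rw [hu, abs_mul, abs_mul, abs_boolSign, abs_boolSign, abs_of_nonneg ha]
        linarith
      have e : 1 + a * -boolSign (z j) * boolSign b = 1 - u := by rw [hu]; ring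
      rw [e, Real.sqrt_div' _ (by positivity), Real.sqrt_div' _ (by positivity), ← sub_div,
        div_pow, Real.sq_sqrt (by positivity), div_le_div_iff₀ (by positivity) hm]
      have := sqrt_sub_sqrt_sq_le (abs_le.1 hub).1 (abs_le.1 hub).2
      rw [hu2] at this
      nlinarith
    rw [Fintype.sum_bool]
    refine (add_le_add (this true) (this false)).trans (le_of_eq ?_)
    ring
  · intro j' _ hj'
    simp [paninski, Function.update_of_ne hj']
  · simp

/-- Flipping the sign at `j` is an involution that negates `boolSign (z j)`, so the sum is half of
its antisymmetrization. -/
theorem two_mul_abs_sum_boolSign_le [DecidableEq P] (g : (P → Bool) → ℝ) (j : P) :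
    2 * |∑ z, g z * boolSign (z j)| ≤ ∑ z, |g z - g (Function.update z j (!z j))| := by
  let e : (P → Bool) ≃ (P → Bool) :=
    Function.Involutive.toPerm (fun z => Function.update z j (!z j)) (fun z => by simp)
  have h1 : ∑ z, g z * boolSign (z j) =
      -∑ z, g (Function.update z j (!z j)) * boolSign (z j) := by
    rw [← Equiv.sum_comp e, ← sum_neg_distrib]
    refine sum_congr rfl fun z _ => ?_
    change g (Function.update z j (!z j)) * boolSign (Function.update z j (!z j) j) = _
    rw [Function.update_self, boolSign_not]
    ring
  have h2 : 2 * ∑ z, g z * boolSign (z j) =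
      ∑ z, (g z - g (Function.update z j (!z j))) * boolSign (z j) := by
    simp only [sub_mul, sum_sub_distrib]
    linarith
  calc 2 * |∑ z, g z * boolSign (z j)| = |2 * ∑ z, g z * boolSign (z j)| := by
        rw [abs_mul]; norm_num
    _ ≤ _ := by
        rw [h2]
        refine (abs_sum_le_sum_abs _ _).trans (sum_le_sum fun z _ => ?_)
        rw [abs_mul, abs_boolSign, mul_one]

/-- The bias of the next sample is `a / (2 m)`, for `m` pairs, times the correlation of the past
with the sign of its pair. That correlation is at most half of the average distance between the laws
of the past before and after a flip, which `T` controls. -/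
theorem transportCost_paninski_le [DecidableEq P] [Nonempty P] {a : ℝ} (ha : 0 ≤ a)
    (z₀ : P → Bool) (n : ℕ) {T : ℝ}
    (hT : ∀ t < n, ∀ z : P → Bool, ∀ j, ∑ x : Fin t → P × Bool,
      |∏ i, paninski a z (x i) - ∏ i, paninski a (Function.update z j (!z j)) (x i)| ≤ T) :
    transportCost (paninski a) (paninski 0 z₀)
      (fun _ : P → Bool => (Fintype.card (P → Bool) : ℝ)⁻¹) n ≤ n * (a * T / 4) := by
  have hm : (0 : ℝ) < Fintype.card P := by exact_mod_cast Fintype.card_pos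
  have hM : (0 : ℝ) < Fintype.card (P → Bool) := by exact_mod_cast Fintype.card_pos
  set M : ℝ := ((Fintype.card (P → Bool) : ℕ) : ℝ) with hMdef
  set m : ℝ := ((Fintype.card P : ℕ) : ℝ) with hmdef
  unfold transportCost
  refine (sum_le_sum (g := fun _ => a * T / 4) fun t ht => ?_).trans (by simp)
  rw [mem_range] at ht
  have h1 : ∀ (x : Fin t → P × Bool) (y : P × Bool),
      |∑ z, M⁻¹ * (∏ i, paninski a z (x i)) * (paninski a z y - paninski 0 z₀ y)| ≤
      a / (4 * m) * M⁻¹ * ∑ z : P → Bool, |∏ i, paninski a z (x i) -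
        ∏ i, paninski a (Function.update z y.1 (!z y.1)) (x i)| := by
    intro x y
    have e : ∑ z, M⁻¹ * (∏ i, paninski a z (x i)) * (paninski a z y - paninski 0 z₀ y) =
        a / (2 * m) * M⁻¹ * boolSign y.2 *
          ∑ z : P → Bool, (∏ i, paninski a z (x i)) * boolSign (z y.1) := by
      rw [mul_sum]
      refine sum_congr rfl fun z _ => ?_
      rw [paninski_sub]
      ring
    rw [e, abs_mul, abs_mul, abs_boolSign, abs_of_nonneg (by positivity)]
    have := two_mul_abs_sum_boolSign_le (fun z => ∏ i, paninski a z (x i)) y.1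
    calc _ = a / (4 * m) * M⁻¹ *
          (2 * |∑ z : P → Bool, (∏ i, paninski a z (x i)) * boolSign (z y.1)|) := by
          field_simp; ring
      _ ≤ _ := mul_le_mul_of_nonneg_left this (by positivity)
  calc _ ≤ ∑ x : Fin t → P × Bool, (1 / 2) * ∑ y : P × Bool,
        a / (4 * m) * M⁻¹ * ∑ z : P → Bool, |∏ i, paninski a z (x i) -
          ∏ i, paninski a (Function.update z y.1 (!z y.1)) (x i)| :=
        sum_le_sum fun x _ => mul_le_mul_of_nonneg_left (sum_le_sum fun y _ => h1 x y)
          (by norm_num)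
    _ = (1 / 2) * (a / (4 * m) * M⁻¹) * ∑ y : P × Bool, ∑ z : P → Bool,
        ∑ x : Fin t → P × Bool, |∏ i, paninski a z (x i) -
          ∏ i, paninski a (Function.update z y.1 (!z y.1)) (x i)| := by
        simp only [← mul_sum]
        rw [sum_comm]
        rw [mul_assoc (1 / 2 : ℝ)]
        congr 2
        exact sum_congr rfl fun y _ => sum_comm
    _ ≤ (1 / 2) * (a / (4 * m) * M⁻¹) * ∑ y : P × Bool, ∑ z : P → Bool, T := by
        refine mul_le_mul_of_nonneg_left ?_ (by positivity)
        exact sum_le_sum fun y _ => sum_le_sum fun z _ => hT t ht z y.1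
    _ = a * T / 4 := by
        simp only [sum_const, card_univ, nsmul_eq_mul, Fintype.card_prod, Fintype.card_bool,
          Nat.cast_mul, ← hMdef, ← hmdef]
        push_cast
        field_simp

theorem transportCost_paninski_le_linear [DecidableEq P] [Nonempty P] {a : ℝ} (ha : 0 ≤ a)
    (ha1 : a ≤ 1) (z₀ : P → Bool) (n : ℕ) :
    transportCost (paninski a) (paninski 0 z₀)
      (fun _ : P → Bool => (Fintype.card (P → Bool) : ℝ)⁻¹) n ≤
        n * (a ^ 2 / 2 * (n / Fintype.card P)) := by
  refine (transportCost_paninski_le ha z₀ n (T := n * (2 * a / Fintype.card P)) ?_).trans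
    (le_of_eq (by ring))
  intro t ht z j
  refine (sum_abs_prod_sub_le (paninski_nonneg ha ha1 z) (sum_paninski a z)
    (paninski_nonneg ha ha1 _) (sum_paninski a _) t).trans ?_
  rw [sum_abs_paninski_flip ha]
  have : (t : ℝ) ≤ n := by exact_mod_cast ht.le
  gcongr

theorem transportCost_paninski_le_sqrt [DecidableEq P] [Nonempty P] {a : ℝ} (ha : 0 ≤ a)
    (ha1 : a ≤ 1) (z₀ : P → Bool) (n : ℕ) :
    transportCost (paninski a) (paninski 0 z₀)
      (fun _ : P → Bool => (Fintype.card (P → Bool) : ℝ)⁻¹) n ≤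
        n * (a ^ 2 / 2 * √(2 * n / Fintype.card P)) := by
  have e : √(n * (2 * a ^ 2 / Fintype.card P)) = a * √(2 * n / Fintype.card P) := by
    rw [show (n : ℝ) * (2 * a ^ 2 / Fintype.card P) = a ^ 2 * (2 * n / Fintype.card P) by ring,
      Real.sqrt_mul (by positivity), Real.sqrt_sq ha]
  refine (transportCost_paninski_le ha z₀ n (T := 2 * √(n * (2 * a ^ 2 / Fintype.card P)))
    ?_).trans (le_of_eq (by rw [e]; ring))
  intro t ht z j
  refine (sum_abs_prod_sub_le_sqrt (paninski_nonneg ha ha1 z) (sum_paninski a z)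
    (paninski_nonneg ha ha1 _) (sum_paninski a _) t).trans ?_
  have : (t : ℝ) ≤ n := by exact_mod_cast ht.le
  have h := sum_sqrt_paninski_flip_le ha ha1 z j
  gcongr

theorem card_mul_sum_paninski_mul [Nonempty P] (a : ℝ) (z z' : P → Bool) :
    ∑ x, paninski a z x * (2 * Fintype.card P * paninski a z' x) =
      1 + a ^ 2 / Fintype.card P * ∑ j, boolSign (z j) * boolSign (z' j) := by
  have hm : (0 : ℝ) < Fintype.card P := by exact_mod_cast Fintype.card_pos
  rw [Fintype.sum_prod_type]
  have : ∀ j, ∑ b, paninski a z (j, b) * (2 * Fintype.card P * paninski a z' (j, b)) =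
      (Fintype.card P : ℝ)⁻¹ +
        a ^ 2 / Fintype.card P * (boolSign (z j) * boolSign (z' j)) := by
    intro j
    simp only [paninski, Fintype.sum_bool, boolSign, if_true, Bool.false_eq_true, if_false]
    field_simp
    ring
  simp only [this, sum_add_distrib, ← mul_sum]
  simp

theorem sum_exp_boolSign_le [DecidableEq P] (θ : ℝ) (z' : P → Bool) :
    (Fintype.card (P → Bool) : ℝ)⁻¹ *
      ∑ z : P → Bool, Real.exp (θ * ∑ j, boolSign (z j) * boolSign (z' j)) ≤
      Real.exp (Fintype.card P * (θ ^ 2 / 2)) := by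
  have h1 : ∑ z : P → Bool, Real.exp (θ * ∑ j, boolSign (z j) * boolSign (z' j)) =
      (2 * Real.cosh θ) ^ Fintype.card P := by
    simp only [mul_sum, Real.exp_sum]
    have := (prod_univ_sum (fun _ : P => (univ : Finset Bool))
      fun j b => Real.exp (θ * (boolSign b * boolSign (z' j)))).symm
    rw [Fintype.piFinset_univ] at this
    rw [this]
    have h : ∀ j, ∑ b, Real.exp (θ * (boolSign b * boolSign (z' j))) = 2 * Real.cosh θ := by
      intro j
      rw [Real.cosh_eq, Fintype.sum_bool]
      cases z' j <;> simp [boolSign] <;> ring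
    rw [prod_congr rfl fun j _ => h j, prod_const, card_univ]
  have h2 : (Fintype.card (P → Bool) : ℝ) = 2 ^ Fintype.card P := by simp
  rw [h1, h2, mul_pow, inv_mul_cancel_left₀ (by positivity), Real.exp_nat_mul]
  exact pow_le_pow_left₀ (Real.cosh_pos θ).le (Real.cosh_le_exp_half_sq θ) _

/-- Ingster's second moment bound for the mixture of Paninski's perturbations. -/
theorem prob_add_prob_paninski_le [DecidableEq P] [Nonempty P] {a : ℝ} (ha : 0 ≤ a) (ha1 : a ≤ 1)
    (z₀ : P → Bool) {n : ℕ} {F H : (Fin n → P × Bool) → ℝ} (hH0 : ∀ x, 0 ≤ H x)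
    (hH1 : ∀ x, H x ≤ 1) (hFH : ∀ x, F x + H x ≤ 1) :
    prodE (paninski 0 z₀) n F +
        ∑ z : P → Bool, (Fintype.card (P → Bool) : ℝ)⁻¹ * prodE (paninski a z) n H ≤
      1 + √(Real.exp (n ^ 2 * a ^ 4 / (2 * Fintype.card P)) - 1) := by
  have hm : (0 : ℝ) < Fintype.card P := by exact_mod_cast Fintype.card_pos
  have hM : (0 : ℝ) < Fintype.card (P → Bool) := by exact_mod_cast Fintype.card_pos
  set K : ℝ := ((Fintype.card (P → Bool) : ℕ) : ℝ) with hK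
  set m : ℝ := ((Fintype.card P : ℕ) : ℝ) with hmdef
  set Q : ℝ := (1 / (2 * m)) ^ n with hQ
  have hQ0 : 0 < Q := by positivity
  have hQi : Q⁻¹ = (2 * m) ^ n := by rw [hQ, one_div, inv_pow, inv_inv]
  set R : (Fin n → P × Bool) → ℝ := fun x => ∑ z : P → Bool, K⁻¹ * ∏ i, paninski a z (x i)
  have hcard : (Fintype.card (Fin n → P × Bool) : ℝ) = Q⁻¹ := by
    rw [hQi, hmdef]
    simp [mul_comm]
  have hR1 : ∑ x, R x = 1 := by
    simp only [R]
    rw [sum_comm]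
    have : ∀ z : P → Bool, ∑ x : Fin n → P × Bool, ∏ i, paninski a z (x i) = 1 := fun z => by
      simpa [prodE] using prodE_const (sum_paninski a z) n 1
    simp only [← mul_sum, this]
    simp [hK]
  have hF : prodE (paninski 0 z₀) n F ≤ 1 - ∑ x, Q * H x := by
    calc prodE (paninski 0 z₀) n F ≤ prodE (paninski 0 z₀) n (fun x => 1 + -1 * H x) :=
          prodE_mono (paninski_nonneg le_rfl zero_le_one z₀) fun x => by linarith [hFH x]
      _ = _ := by
          rw [prodE_add, prodE_const_mul, prodE_const (sum_paninski 0 z₀)]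
          simp [prodE, paninski_zero, hQ, hmdef, sub_eq_add_neg]
  have hHm : ∑ z : P → Bool, K⁻¹ * prodE (paninski a z) n H = ∑ x, R x * H x := by
    simp only [R, prodE, mul_sum, sum_mul]
    rw [sum_comm]
    exact sum_congr rfl fun x _ => sum_congr rfl fun z _ => by ring
  have hR2 : Q⁻¹ * ∑ x, R x ^ 2 ≤ Real.exp (n ^ 2 * a ^ 4 / (2 * m)) := by
    have e1 : Q⁻¹ * ∑ x, R x ^ 2 = K⁻¹ * ∑ z' : P → Bool, (K⁻¹ * ∑ z : P → Bool,
        (1 + a ^ 2 / m * ∑ j, boolSign (z j) * boolSign (z' j)) ^ n) := by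
      have : ∀ z z' : P → Bool, (1 + a ^ 2 / m * ∑ j, boolSign (z j) * boolSign (z' j)) ^ n =
          Q⁻¹ * ∑ x : Fin n → P × Bool, (∏ i, paninski a z (x i)) * ∏ i, paninski a z' (x i) := by
        intro z z'
        rw [← card_mul_sum_paninski_mul, ← prodE_prod, prodE, mul_sum]
        refine sum_congr rfl fun x _ => ?_
        rw [prod_mul_distrib, prod_const, card_univ, Fintype.card_fin, hQi]
        ring
      simp only [this]
      calc _ = ∑ x : Fin n → P × Bool, ∑ z' : P → Bool, ∑ z : P → Bool, Q⁻¹ *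
            ((K⁻¹ * ∏ i, paninski a z' (x i)) * (K⁻¹ * ∏ i, paninski a z (x i))) := by
            rw [mul_sum]
            refine sum_congr rfl fun x _ => ?_
            simp only [sq, R]
            rw [sum_mul_sum]
            simp only [mul_sum]
        _ = ∑ z' : P → Bool, ∑ z : P → Bool, ∑ x : Fin n → P × Bool, Q⁻¹ *
            ((K⁻¹ * ∏ i, paninski a z' (x i)) * (K⁻¹ * ∏ i, paninski a z (x i))) := by
            rw [sum_comm]
            exact sum_congr rfl fun z' _ => sum_comm
        _ = _ := by
            simp only [mul_sum]
            refine sum_congr rfl fun z' _ => sum_congr rfl fun z _ => sum_congr rfl fun x _ => ?_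
            ring
    rw [e1]
    have h2 : ∀ z' : P → Bool, K⁻¹ * ∑ z : P → Bool,
        (1 + a ^ 2 / m * ∑ j, boolSign (z j) * boolSign (z' j)) ^ n ≤
        Real.exp (n ^ 2 * a ^ 4 / (2 * m)) := by
      intro z'
      have h3 := sum_exp_boolSign_le (n * (a ^ 2 / m)) z'
      have e : (Fintype.card P : ℝ) * ((n * (a ^ 2 / m)) ^ 2 / 2) = n ^ 2 * a ^ 4 / (2 * m) := by
        rw [← hmdef]
        field_simp
      rw [e] at h3
      refine le_trans (mul_le_mul_of_nonneg_left (sum_le_sum fun z _ => ?_) (by positivity)) h3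
      -- Raising `1 + x ≤ exp x` to the power `n` needs `0 ≤ 1 + x`; this holds because `1 + x` is
      -- the inner product of two densities.
      have hnn : 0 ≤ 1 + a ^ 2 / m * ∑ j, boolSign (z j) * boolSign (z' j) := by
        rw [← card_mul_sum_paninski_mul]
        exact sum_nonneg fun x _ => mul_nonneg (paninski_nonneg ha ha1 _ _)
          (mul_nonneg (by positivity) (paninski_nonneg ha ha1 _ _))
      rw [mul_assoc (n : ℝ), Real.exp_nat_mul]
      refine pow_le_pow_left₀ hnn ?_ n
      linarith [Real.add_one_le_exp (a ^ 2 / m * ∑ j, boolSign (z j) * boolSign (z' j))]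
    calc _ ≤ K⁻¹ * ∑ z' : P → Bool, Real.exp (n ^ 2 * a ^ 4 / (2 * m)) :=
          mul_le_mul_of_nonneg_left (sum_le_sum fun z' _ => h2 z') (by positivity)
      _ = _ := by
          simp only [sum_const, card_univ, nsmul_eq_mul, ← hK]
          field_simp
  have hvar : Q⁻¹ * ∑ x, (R x - Q) ^ 2 = Q⁻¹ * ∑ x, R x ^ 2 - 1 := by
    have : ∀ x, (R x - Q) ^ 2 = R x ^ 2 - 2 * Q * R x + Q ^ 2 := fun x => by ring
    simp only [this, sum_add_distrib, sum_sub_distrib, ← mul_sum, hR1, sum_const, card_univ,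
      nsmul_eq_mul, hcard]
    field_simp
    ring
  have hcs := sum_mul_sq_le_sq_mul_sq univ (fun x => R x - Q) H
  have hH2 : ∑ x, H x ^ 2 ≤ Q⁻¹ := by
    rw [← hcard, ← card_univ, ← nsmul_one]
    exact sum_le_card_nsmul _ _ _ fun x _ => by nlinarith [hH0 x, hH1 x]
  have hdiff : ∑ x, (R x - Q) * H x ≤ √(Real.exp (n ^ 2 * a ^ 4 / (2 * m)) - 1) := by
    refine Real.le_sqrt_of_sq_le (hcs.trans ?_)
    have h0 : 0 ≤ ∑ x, (R x - Q) ^ 2 := sum_nonneg fun x _ => sq_nonneg _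
    calc _ ≤ (∑ x, (R x - Q) ^ 2) * Q⁻¹ := mul_le_mul_of_nonneg_left hH2 h0
      _ = Q⁻¹ * ∑ x, (R x - Q) ^ 2 := mul_comm _ _
      _ ≤ _ := by rw [hvar]; linarith
  rw [hHm]
  simp only [sub_mul, sum_sub_distrib] at hdiff
  linarith

end paninski

end Paninski

/-! ### From schemes under attack to functions of the raw samples. -/

section SchemeLowerBound

open Finset MeasureTheory

variable {k n : ℕ} {𝒴 : Type} {𝒲 : Set (Channel k 𝒴)}

open Classical in
/-- There is an attack that makes the server answer `b` whenever some attack can. -/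
theorem Scheme.exists_attack [Countable 𝒴] (S : Scheme k n 𝒲) {γ : ℝ} (hγ : 0 ≤ γ) (b : Bool) :
    ∃ M, S.IsAttack γ M ∧ ∀ u y z, (hammingDist z y : ℝ) ≤ γ * n → S.T u z = b →
      S.T u (M u y) = b := by
  let _ := S.mΩ
  let _ : Encodable (Fin n → 𝒴) := Encodable.ofCountable _
  set G : S.Ω → (Fin n → 𝒴) → (Fin n → 𝒴) → Prop := fun u y z =>
    (hammingDist z y : ℝ) ≤ γ * n ∧ S.T u z = b with hG
  -- The attack moves to the first admissible target in an enumeration of the message vectors, or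
  -- stays put if there is none. Countability makes this choice measurable in the coin.
  set R : S.Ω → (Fin n → 𝒴) → (Fin n → 𝒴) → Prop := fun u y z =>
    (G u y z ∧ ∀ z', Encodable.encode z' < Encodable.encode z → ¬G u y z') ∨
      (z = y ∧ ∀ z', ¬G u y z') with hR
  have hex : ∀ u y, ∃ z, R u y z := by
    intro u y
    by_cases h : ∃ z, G u y z
    · have h' : ∃ m, ∃ z, Encodable.encode z = m ∧ G u y z := by
        obtain ⟨z, hz⟩ := h
        exact ⟨_, z, rfl, hz⟩
      obtain ⟨z, hz1, hz2⟩ := Nat.find_spec h'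
      refine ⟨z, Or.inl ⟨hz2, fun z' hz' hG' => ?_⟩⟩
      rw [hz1] at hz'
      exact Nat.find_min h' hz' ⟨z', rfl, hG'⟩
    · push Not at h
      exact ⟨y, Or.inr ⟨rfl, h⟩⟩
  have huniq : ∀ u y z z', R u y z → R u y z' → z = z' := by
    rintro u y z z' (⟨h1, h2⟩ | ⟨h1, h2⟩) (⟨h3, h4⟩ | ⟨h3, h4⟩)
    · rcases lt_trichotomy (Encodable.encode z) (Encodable.encode z') with h | h | h
      · exact absurd h1 (h4 _ h)
      · exact Encodable.encode_injective h
      · exact absurd h3 (h2 _ h)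
    · exact absurd h1 (h4 _)
    · exact absurd h3 (h2 _)
    · rw [h1, h3]
  choose M hM using hex
  have hGm : ∀ y z, Measurable fun u => G u y z := by
    intro y z
    refine Measurable.and measurable_const ?_
    cases b
    · have h := (measurableSet_setOfPred.1 (S.measurable_T z)).not
      simpa using h
    · exact measurableSet_setOfPred.1 (S.measurable_T z)
  refine ⟨M, ⟨fun u y => ?_, fun y z => ?_⟩, fun u y z h1 h2 => ?_⟩
  · rcases hM u y with ⟨h, -⟩ | ⟨h, -⟩
    · exact h.1
    · rw [h, hammingDist_self]
      simp only [Nat.cast_zero]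
      positivity
  · have : {u | M u y = z} = {u | R u y z} := by
      ext u
      exact ⟨fun h => h ▸ hM u y, fun h => huniq u y _ _ (hM u y) h⟩
    rw [this]
    exact measurableSet_setOfPred.2 (((hGm y z).and (Measurable.forall fun z' =>
      measurable_const.imp (hGm y z').not)).or (measurable_const.and
        (Measurable.forall fun z' => (hGm y z').not)))
  · rcases hM u y with ⟨h, -⟩ | ⟨-, h⟩
    · exact h.2
    · exact absurd ⟨h1, h2⟩ (h z)

theorem ofReal_prodE_toReal (p : PMF (Fin k)) (F : (Fin n → Fin k) → ℝ) (hF : ∀ x, 0 ≤ F x) :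
    ENNReal.ofReal (prodE (fun x => (p x).toReal) n F) =
      ∑ x, (∏ i, p (x i)) * ENNReal.ofReal (F x) := by
  rw [prodE, ENNReal.ofReal_sum_of_nonneg fun x _ =>
    mul_nonneg (prod_nonneg fun _ _ => ENNReal.toReal_nonneg) (hF x)]
  refine sum_congr rfl fun x _ => ?_
  rw [ENNReal.ofReal_mul (prod_nonneg fun _ _ => ENNReal.toReal_nonneg),
    ENNReal.ofReal_prod_of_nonneg fun _ _ => ENNReal.toReal_nonneg]
  simp [ENNReal.ofReal_toReal (PMF.apply_ne_top _ _)]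

/-- The law of the random maps from samples to messages, one for each user, that realize the
channels `W`. -/
def channelMeasure [m : MeasurableSpace 𝒴] (W : Fin n → Channel k 𝒴) :
    Measure (Fin n → Fin k → 𝒴) :=
  Measure.pi fun i => Measure.pi fun x => (W i x).toMeasure

instance [MeasurableSpace 𝒴] (W : Fin n → Channel k 𝒴) :
    IsProbabilityMeasure (channelMeasure W) := by
  unfold channelMeasure
  infer_instance

theorem channelMeasure_apply [Countable 𝒴] [MeasurableSpace 𝒴] [DiscreteMeasurableSpace 𝒴]
    (W : Fin n → Channel k 𝒴) (x : Fin n → Fin k) (Q : (Fin n → 𝒴) → Prop) [DecidablePred Q] :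
    channelMeasure W {Φ | Q fun i => Φ i (x i)} =
      ∑' y : Fin n → 𝒴, if Q y then ∏ i, W i (x i) (y i) else 0 := by
  have hmp : MeasurePreserving (fun (Φ : Fin n → Fin k → 𝒴) i => Φ i (x i)) (channelMeasure W)
      (Measure.pi fun i => (W i (x i)).toMeasure) :=
    measurePreserving_pi _ _ fun i =>
      measurePreserving_eval (fun x => (W i x).toMeasure) (x i)
  have hQ : MeasurableSet {y | Q y} := (Set.to_countable _).measurableSet
  have h1 := hmp.measure_preimage hQ.nullMeasurableSet
  rw [Set.preimage_ofPred_eq] at h1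
  classical
  rw [h1, ← Measure.tsum_indicator_apply_singleton _ _ hQ]
  refine tsum_congr fun y => ?_
  rw [Set.indicator_apply]
  simp only [Set.mem_ofPred_eq, Measure.pi_singleton]
  split_ifs <;> try rfl
  exact prod_congr rfl fun i _ => PMF.toMeasure_apply_singleton _ _ (measurableSet_singleton _)

/-- All randomness of the channels is drawn in advance as maps `Φ i`. For fixed `Φ` the messages are
a deterministic coordinatewise function of the samples, as the contraction of Hamming distance
requires. -/
theorem tsum_messageProb [Countable 𝒴] [MeasurableSpace 𝒴] [DiscreteMeasurableSpace 𝒴]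
    (p : PMF (Fin k)) (W : Fin n → Channel k 𝒴) (Q : (Fin n → 𝒴) → Prop) [DecidablePred Q] :
    ∑' y, (if Q y then messageProb p W y else 0) =
      ∫⁻ Φ, ENNReal.ofReal (prodE (fun x => (p x).toReal) n
        fun x => if Q fun i => Φ i (x i) then 1 else 0) ∂channelMeasure W := by
  have h0 : ∀ Φ : Fin n → Fin k → 𝒴, ENNReal.ofReal (prodE (fun x => (p x).toReal) n
        fun x => if Q fun i => Φ i (x i) then 1 else 0) =
      ∑ x : Fin n → Fin k, (∏ i, p (x i)) * Set.indicator {Φ : Fin n → Fin k → 𝒴 | Q fun i => Φ i (x i)} (fun _ => 1) Φ := by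
    intro Φ
    rw [ofReal_prodE_toReal _ _ fun x => by split_ifs <;> norm_num]
    refine sum_congr rfl fun x _ => ?_
    rw [Set.indicator_apply]
    simp only [Set.mem_ofPred_eq]
    split_ifs <;> simp
  have hmeas : ∀ x : Fin n → Fin k, MeasurableSet {Φ : Fin n → Fin k → 𝒴 | Q fun i => Φ i (x i)} :=
    fun x => (Set.to_countable _).measurableSet
  simp only [h0]
  rw [lintegral_finsetSum _ fun x _ => (measurable_const.indicator (hmeas x)).const_mul _]
  have h1 : ∀ y : Fin n → 𝒴, (if Q y then messageProb p W y else 0) =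
      ∑ x : Fin n → Fin k, (∏ i, p (x i)) * if Q y then ∏ i, W i (x i) (y i) else 0 := by
    intro y
    split_ifs with h
    · rw [messageProb, prod_univ_sum, Fintype.piFinset_univ]
      exact sum_congr rfl fun x _ => prod_mul_distrib
    · simp
  simp only [h1]
  rw [Summable.tsum_finsetSum fun _ _ => ENNReal.summable]
  refine sum_congr rfl fun x _ => ?_
  rw [ENNReal.tsum_mul_left, ← channelMeasure_apply,
    lintegral_const_mul _ (measurable_const.indicator (hmeas x)),
    lintegral_indicator_const (hmeas x), one_mul]

/-- Superadditivity of the lower integral needs no measurability, and only this direction is used.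
-/
theorem sum_lintegral_le {Ω ι : Type*} [MeasurableSpace Ω] (μ : Measure Ω) (s : Finset ι)
    (f : ι → Ω → ℝ≥0∞) : ∑ i ∈ s, ∫⁻ u, f i u ∂μ ≤ ∫⁻ u, ∑ i ∈ s, f i u ∂μ := by
  classical
  induction s using Finset.induction_on with
  | empty => simp
  | insert i s hi ih =>
    simp only [sum_insert hi]
    exact (add_le_add le_rfl ih).trans (le_lintegral_add _ _)

theorem lintegral_add_sum_le {Ω ι : Type*} [Fintype ι] [MeasurableSpace Ω] (μ : Measure Ω)
    [IsProbabilityMeasure μ] {w : ι → ℝ} {g : Ω → ℝ≥0∞} {f : ι → Ω → ℝ≥0∞} {B : ℝ≥0∞}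
    (h : ∀ u, g u + ∑ i, ENNReal.ofReal (w i) * f i u ≤ B) :
    ∫⁻ u, g u ∂μ + ∑ i, ENNReal.ofReal (w i) * ∫⁻ u, f i u ∂μ ≤ B := by
  calc _ = ∫⁻ u, g u ∂μ + ∑ i, ∫⁻ u, ENNReal.ofReal (w i) * f i u ∂μ := by
        congr 1
        exact sum_congr rfl fun i _ => (lintegral_const_mul' _ _ ENNReal.ofReal_ne_top).symm
    _ ≤ ∫⁻ u, (g u + ∑ i, ENNReal.ofReal (w i) * f i u) ∂μ :=
        (add_le_add le_rfl (sum_lintegral_le μ univ _)).trans (le_lintegral_add _ _)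
    _ ≤ ∫⁻ _, B ∂μ := lintegral_mono h
    _ = B := by simp

open Classical in
theorem Scheme.Tests.lower_bound [Countable 𝒴] {S : Scheme k n 𝒲} {γ α : ℝ} (hγ : 0 ≤ γ)
    {q : PMF (Fin k)} (hS : S.Tests γ α q) {Z : Type*} [Fintype Z] {p : Z → PMF (Fin k)}
    {w : Z → ℝ} (hw : ∀ z, 0 ≤ w z) (hw1 : ∑ z, w z = 1) (hp : ∀ z, α ≤ dTV (p z) q) {B : ℝ}
    (hB : ∀ F H : (Fin n → Fin k) → ℝ, (∀ x, 0 ≤ F x) → (∀ x, F x ≤ 1) → (∀ x, 0 ≤ H x) →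
      (∀ x, H x ≤ 1) → (∀ x x', (hammingDist x x' : ℝ) ≤ γ * n → F x + H x' ≤ 1) →
      prodE (fun x => (q x).toReal) n F + ∑ z, w z * prodE (fun x => (p z x).toReal) n H ≤ B) :
    9 / 5 ≤ B := by
  let _ := S.mΩ
  have _ := S.isProb
  let _ : MeasurableSpace 𝒴 := ⊤
  have _ : DiscreteMeasurableSpace 𝒴 := ⟨fun _ => trivial⟩
  -- Under `q` the adversary aims at "no", under the alternatives at "yes".
  obtain ⟨M, hM, hM'⟩ := S.exists_attack hγ false
  obtain ⟨M₁, hM₁, hM₁'⟩ := S.exists_attack hγ true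
  have h1 : ENNReal.ofReal (9 / 10) ≤ S.answerProb M q true := by
    refine le_trans (le_of_eq ?_) (hS M hM).1.le
    rw [ENNReal.ofReal_div_of_pos (by norm_num)]
    norm_num
  have h2 : ∀ z, ENNReal.ofReal (9 / 10) ≤ S.answerProb M₁ (p z) false := fun z => by
    refine le_trans (le_of_eq ?_) ((hS M₁ hM₁).2 (p z) (hp z)).le
    rw [ENNReal.ofReal_div_of_pos (by norm_num)]
    norm_num
  have h3 : S.answerProb M q true + ∑ z, ENNReal.ofReal (w z) * S.answerProb M₁ (p z) false ≤
      ENNReal.ofReal B := by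
    unfold Scheme.answerProb
    refine lintegral_add_sum_le S.μ fun u => ?_
    simp only [fun (M : (Fin n → 𝒴) → (Fin n → 𝒴)) r b =>
      tsum_messageProb r (S.W u) fun y => S.T u (M y) = b]
    refine lintegral_add_sum_le _ fun Φ => ?_
    have hn : ∀ (r : PMF (Fin k)) (Q : (Fin n → Fin k) → Prop) [DecidablePred Q],
        0 ≤ prodE (fun x => (r x).toReal) n (fun x => if Q x then 1 else 0) := fun r Q _ =>
      prodE_nonneg (fun _ => ENNReal.toReal_nonneg) fun x => by split_ifs <;> norm_num
    simp only [← ENNReal.ofReal_mul (hw _)]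
    rw [← ENNReal.ofReal_sum_of_nonneg fun z _ => mul_nonneg (hw z) (hn _ _),
      ← ENNReal.ofReal_add (hn _ _) (sum_nonneg fun z _ => mul_nonneg (hw z) (hn _ _))]
    refine ENNReal.ofReal_le_ofReal (hB _ _ ?_ ?_ ?_ ?_ ?_)
    · intro x; split_ifs <;> norm_num
    · intro x; split_ifs <;> norm_num
    · intro x; split_ifs <;> norm_num
    · intro x; split_ifs <;> norm_num
    · intro x x' hxx'
      have hle : ((hammingDist (fun i => Φ i (x' i)) (fun i => Φ i (x i)) : ℕ) : ℝ) ≤ γ * n := by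
        refine le_trans ?_ hxx'
        rw [hammingDist_comm x x']
        exact_mod_cast hammingDist_map_le Φ x' x
      have hle' : ((hammingDist (fun i => Φ i (x' i)) (fun i => Φ i (x' i)) : ℕ) : ℝ) ≤ γ * n := by
        rw [hammingDist_self]
        simp only [Nat.cast_zero]
        positivity
      -- The unmodified messages of `x'` decide: if they are answered "no", the attack from `x` can
      -- reach them and `F x = 0`; if "yes", the attack from `x'` already succeeds and `H x' = 0`.
      cases hT : S.T u fun i => Φ i (x' i)
      · rw [hM' u _ _ hle hT]
        split_ifs <;> norm_num at *
      · rw [hM₁' u _ _ hle' hT]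
        split_ifs <;> norm_num at *
  have h4 : ENNReal.ofReal (9 / 5) ≤ ENNReal.ofReal B := by
    refine le_trans ?_ ((add_le_add h1 (sum_le_sum fun z _ =>
      mul_le_mul_right (h2 z) (ENNReal.ofReal (w z)))).trans h3)
    rw [← sum_mul, ← ENNReal.ofReal_sum_of_nonneg fun z _ => hw z, hw1, ENNReal.ofReal_one, one_mul,
      ← ENNReal.ofReal_add (by norm_num) (by norm_num)]
    norm_num
  by_contra hcon
  push Not at hcon
  have := (ENNReal.ofReal_lt_ofReal_iff (by norm_num)).2 hcon
  exact absurd h4 (not_le.2 this)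

/-- The distribution on `[k]` of `φ a`, when `a` has the distribution with the weights `w`. -/
def pushPMF {A : Type*} [Fintype A] (φ : A → Fin k) (w : A → ℝ) (hw : ∀ a, 0 ≤ w a)
    (hw1 : ∑ a, w a = 1) : PMF (Fin k) :=
  PMF.ofFintype (fun b => ENNReal.ofReal (∑ a with φ a = b, w a)) (by
    rw [← ENNReal.ofReal_sum_of_nonneg fun b _ => sum_nonneg fun a _ => hw a, sum_fiberwise, hw1,
      ENNReal.ofReal_one])

theorem pushPMF_toReal {A : Type*} [Fintype A] (φ : A → Fin k) (w : A → ℝ) (hw : ∀ a, 0 ≤ w a)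
    (hw1 : ∑ a, w a = 1) :
    (fun b => (pushPMF φ w hw hw1 b).toReal) = fun b => ∑ a with φ a = b, w a := by
  funext b
  rw [pushPMF, PMF.ofFintype_apply, ENNReal.toReal_ofReal (sum_nonneg fun a _ => hw a)]

theorem le_dTV_pushPMF {A : Type*} [Fintype A] {φ : A → Fin k} (hφ : Function.Injective φ)
    (v w : A → ℝ) (hv : ∀ a, 0 ≤ v a) (hv1 : ∑ a, v a = 1) (hw : ∀ a, 0 ≤ w a)
    (hw1 : ∑ a, w a = 1) :
    (1 / 2) * ∑ a, |v a - w a| ≤ dTV (pushPMF φ v hv hv1) (pushPMF φ w hw hw1) := by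
  classical
  unfold dTV
  refine mul_le_mul_of_nonneg_left ?_ (by norm_num)
  have h1 : ∀ (u : A → ℝ) a, ∑ a' with φ a' = φ a, u a' = u a := by
    intro u a
    simp [hφ.eq_iff, sum_filter]
  have e : ∀ b, |(pushPMF φ v hv hv1 b).toReal - (pushPMF φ w hw hw1 b).toReal| =
      |∑ a with φ a = b, v a - ∑ a with φ a = b, w a| := fun b => by
    rw [← congrFun (pushPMF_toReal φ v hv hv1) b, ← congrFun (pushPMF_toReal φ w hw hw1) b]
  simp only [e]
  calc ∑ a, |v a - w a| = ∑ b ∈ univ.map ⟨φ, hφ⟩,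
        |∑ a with φ a = b, v a - ∑ a with φ a = b, w a| := by
        rw [sum_map]
        simp [h1]
    _ ≤ _ := sum_le_sum_of_subset_of_nonneg (subset_univ _) fun _ _ _ => abs_nonneg _

/-- The lower bound for distributions that are supported on the image of an embedding. -/
theorem Scheme.Tests.lower_bound_of_embedding [Countable 𝒴] {γ α : ℝ} (hγ : 0 ≤ γ)
    (hS : ∀ q : PMF (Fin k), ∃ S : Scheme k n 𝒲, S.Tests γ α q) {A Z : Type*} [Fintype A]
    [DecidableEq A] [Fintype Z] {φ : A → Fin k} (hφ : Function.Injective φ) {q : A → ℝ} {p : Z → A → ℝ} {w : Z → ℝ}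
    (hq : ∀ a, 0 ≤ q a) (hq1 : ∑ a, q a = 1) (hp : ∀ z a, 0 ≤ p z a) (hp1 : ∀ z, ∑ a, p z a = 1)
    (hw : ∀ z, 0 ≤ w z) (hw1 : ∑ z, w z = 1) (hα : ∀ z, 2 * α ≤ ∑ a, |p z a - q a|) {B : ℝ}
    (hB : ∀ F H : (Fin n → A) → ℝ, (∀ x, 0 ≤ F x) → (∀ x, F x ≤ 1) → (∀ x, 0 ≤ H x) →
      (∀ x, H x ≤ 1) → (∀ x x', (hammingDist x x' : ℝ) ≤ γ * n → F x + H x' ≤ 1) →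
      prodE q n F + ∑ z, w z * prodE (p z) n H ≤ B) :
    9 / 5 ≤ B := by
  obtain ⟨S, hS⟩ := hS (pushPMF φ q hq hq1)
  refine hS.lower_bound hγ (p := fun z => pushPMF φ (p z) (hp z) (hp1 z)) hw hw1 (fun z => ?_) ?_
  · refine le_trans ?_ (le_dTV_pushPMF hφ _ _ _ _ _ _)
    linarith [hα z]
  · intro F H hF hF1 hH hH1 hFH
    simp only [pushPMF_toReal]
    have e : ∀ v : A → ℝ, ∀ F, prodE (fun b => ∑ a with φ a = b, v a) n F =
      prodE v n fun x => F fun i => φ (x i) := fun v F => by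
      rw [← prodE_map]
    simp only [e]
    refine hB _ _ (fun _ => hF _) (fun _ => hF1 _) (fun _ => hH _) (fun _ => hH1 _) ?_
    intro x x' hx
    refine hFH _ _ (le_trans ?_ hx)
    exact_mod_cast hammingDist_map_le (fun _ => φ) x x'

end SchemeLowerBound

/-! ### The four lower bounds. -/

section LowerBound

open Finset

section lower

variable {k n : ℕ} {𝒴 : Type} [Countable 𝒴] {𝒲 : Set (Channel k 𝒴)} {γ α : ℝ}

/-- The embedding of the pairs into `[k]`. -/
def pairEmbedding (k : ℕ) (x : Fin (k / 2) × Bool) : Fin k :=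
  ⟨2 * x.1 + if x.2 then 1 else 0, by
    have := x.1.2
    split_ifs <;> omega⟩

theorem pairEmbedding_injective (k : ℕ) : Function.Injective (pairEmbedding k) := by
  rintro ⟨i, b⟩ ⟨j, c⟩ h
  simp only [pairEmbedding, Fin.mk.injEq] at h
  cases b <;> cases c <;> simp at h ⊢ <;> omega

/-- Amplitude `2 α` puts the alternatives at total variation distance exactly `α` from the uniform
distribution on the pairs. For odd `k` one letter stays unused. -/
theorem lower_bound_paninski (hk : 2 ≤ k) (hγ : 0 ≤ γ) (hα : 0 < α) (hα2 : α ≤ 1 / 2)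
    (hS : ∀ q : PMF (Fin k), ∃ S : Scheme k n 𝒲, S.Tests γ α q) {B : ℝ}
    (hB : ∀ F H : (Fin n → Fin (k / 2) × Bool) → ℝ, (∀ x, 0 ≤ F x) → (∀ x, F x ≤ 1) →
      (∀ x, 0 ≤ H x) → (∀ x, H x ≤ 1) →
      (∀ x x', (hammingDist x x' : ℝ) ≤ γ * n → F x + H x' ≤ 1) →
      prodE (paninski 0 fun _ => true) n F + ∑ z : Fin (k / 2) → Bool,
        (Fintype.card (Fin (k / 2) → Bool) : ℝ)⁻¹ * prodE (paninski (2 * α) z) n H ≤ B) :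
    9 / 5 ≤ B := by
  have : Nonempty (Fin (k / 2)) := ⟨⟨0, by omega⟩⟩
  refine Scheme.Tests.lower_bound_of_embedding hγ hS (pairEmbedding_injective k)
    (paninski_nonneg le_rfl zero_le_one _) (sum_paninski _ _)
    (paninski_nonneg (by linarith) (by linarith)) (sum_paninski _) (fun _ => by positivity) ?_
    (fun z => (sum_abs_paninski_sub (by linarith) z _).ge) hB
  rw [sum_const, card_univ, nsmul_eq_mul]
  exact mul_inv_cancel₀ (by exact_mod_cast Fintype.card_ne_zero)

theorem le_three_mul_half (hk : 2 ≤ k) : (k : ℝ) ≤ 3 * ((k / 2 : ℕ) : ℝ) := by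
  have : k ≤ 3 * (k / 2) := by omega
  exact_mod_cast this

theorem half_pos_real (hk : 2 ≤ k) : (0 : ℝ) < ((k / 2 : ℕ) : ℝ) := by
  have : 0 < k / 2 := by omega
  exact_mod_cast this

theorem lower_bound_sampling (hk : 2 ≤ k) (hγ : 0 ≤ γ) (hα : 0 < α) (hα2 : α ≤ 1 / 2)
    (hS : ∀ q : PMF (Fin k), ∃ S : Scheme k n 𝒲, S.Tests γ α q) :
    (k : ℝ) < 8 ^ 4 * (n ^ 2 * α ^ 4) := by
  have : Nonempty (Fin (k / 2)) := ⟨⟨0, by omega⟩⟩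
  have hm := half_pos_real hk
  have h := lower_bound_paninski hk hγ hα hα2 hS fun F H _ _ hH hH1 hFH =>
    prob_add_prob_paninski_le (by linarith) (by linarith) (fun _ => true) hH hH1 fun x =>
      hFH x x (by rw [hammingDist_self]; simp only [Nat.cast_zero]; positivity)
  by_contra hcon
  push Not at hcon
  rw [Fintype.card_fin] at h
  set m : ℝ := ((k / 2 : ℕ) : ℝ)
  have hkm : (k : ℝ) ≤ 3 * m := le_three_mul_half hk
  -- With exponent at most `1 / 4` the bound is at most `1 + 3 / 4`, below the required `9 / 5`.
  have hv : (n : ℝ) ^ 2 * (2 * α) ^ 4 / (2 * m) ≤ 1 / 4 := by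
    rw [div_le_iff₀ (by positivity)]
    nlinarith
  have h1 : Real.exp ((n : ℝ) ^ 2 * (2 * α) ^ 4 / (2 * m)) ≤ 3 / 2 := by
    have h2 := Real.exp_bound_div_one_sub_of_interval
      (show 0 ≤ (n : ℝ) ^ 2 * (2 * α) ^ 4 / (2 * m) by positivity) (by linarith)
    refine h2.trans ?_
    rw [div_le_iff₀ (by linarith)]
    linarith
  have h3 : √(Real.exp ((n : ℝ) ^ 2 * (2 * α) ^ 4 / (2 * m)) - 1) ≤ 3 / 4 := by
    rw [Real.sqrt_le_left (by norm_num)]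
    linarith
  linarith

theorem lower_bound_transport (hk : 2 ≤ k) (hγ : 0 < γ) (hn : 1 ≤ n) (hα : 0 < α)
    (hα2 : α ≤ 1 / 2) (hS : ∀ q : PMF (Fin k), ∃ S : Scheme k n 𝒲, S.Tests γ α q) {c : ℝ}
    (hc : transportCost (paninski (2 * α)) (paninski 0 fun _ : Fin (k / 2) => true)
      (fun _ : Fin (k / 2) → Bool => (Fintype.card (Fin (k / 2) → Bool) : ℝ)⁻¹) n ≤ n * c) :
    4 / 5 * γ ≤ c := by
  have : Nonempty (Fin (k / 2)) := ⟨⟨0, by omega⟩⟩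
  have hn' : (0 : ℝ) < n := by exact_mod_cast hn
  have h := lower_bound_paninski hk hγ.le hα hα2 hS fun F H _ hF1 _ hH1 hFH =>
    prob_add_prob_le_of_far (paninski_nonneg le_rfl zero_le_one _) (sum_paninski _ _)
      (paninski_nonneg (by linarith) (by linarith)) (sum_paninski _)
      (fun _ => by positivity)
      (by
        rw [sum_const, card_univ, nsmul_eq_mul]
        exact mul_inv_cancel₀ (by exact_mod_cast Fintype.card_ne_zero))
      (by positivity) hF1 hH1 hFH
  have h1 := div_le_div_of_nonneg_right hc (show 0 ≤ γ * n by positivity)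
  have h2 : n * c / (γ * n) = c / γ := by field_simp
  rw [h2] at h1
  have h3 : 4 / 5 ≤ c / γ := by linarith
  rwa [le_div_iff₀ hγ] at h3

theorem lower_bound_linear (hk : 2 ≤ k) (hγ : 0 < γ) (hn : 1 ≤ n) (hα : 0 < α)
    (hα2 : α ≤ 1 / 2) (hS : ∀ q : PMF (Fin k), ∃ S : Scheme k n 𝒲, S.Tests γ α q) :
    k * γ < 8 ^ 2 * (n * α ^ 2) := by
  have : Nonempty (Fin (k / 2)) := ⟨⟨0, by omega⟩⟩
  have hm := half_pos_real hk
  have hn' : (0 : ℝ) < n := by exact_mod_cast hn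
  have h := lower_bound_transport hk hγ hn hα hα2 hS
    (transportCost_paninski_le_linear (by linarith) (by linarith) _ n)
  rw [Fintype.card_fin] at h
  have hkm := le_three_mul_half hk
  set m : ℝ := ((k / 2 : ℕ) : ℝ)
  have h1 : 4 / 5 * γ * m ≤ 2 * (n * α ^ 2) := by
    calc 4 / 5 * γ * m ≤ ((2 * α) ^ 2 / 2 * (n / m)) * m := mul_le_mul_of_nonneg_right h hm.le
      _ = 2 * (n * α ^ 2) := by field_simp
  have : 0 < n * α ^ 2 := by positivity
  nlinarith [mul_le_mul_of_nonneg_right hkm hγ.le]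

theorem lower_bound_sqrt (hk : 2 ≤ k) (hγ : 0 < γ) (hn : 1 ≤ n) (hα : 0 < α)
    (hα2 : α ≤ 1 / 2) (hS : ∀ q : PMF (Fin k), ∃ S : Scheme k n 𝒲, S.Tests γ α q) :
    k * γ ^ 2 < 8 ^ 4 * (n * α ^ 4) := by
  have : Nonempty (Fin (k / 2)) := ⟨⟨0, by omega⟩⟩
  have hm := half_pos_real hk
  have hn' : (0 : ℝ) < n := by exact_mod_cast hn
  have h := lower_bound_transport hk hγ hn hα hα2 hS
    (transportCost_paninski_le_sqrt (by linarith) (by linarith) _ n)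
  rw [Fintype.card_fin] at h
  have hkm := le_three_mul_half hk
  set m : ℝ := ((k / 2 : ℕ) : ℝ)
  have h1 := pow_le_pow_left₀ (by positivity) h 2
  rw [mul_pow _ (√_), Real.sq_sqrt (by positivity)] at h1
  have h2 : (4 / 5 * γ) ^ 2 * m ≤ 8 * (n * α ^ 4) := by
    calc (4 / 5 * γ) ^ 2 * m ≤ (((2 * α) ^ 2 / 2) ^ 2 * (2 * n / m)) * m :=
          mul_le_mul_of_nonneg_right h1 hm.le
      _ = 8 * (n * α ^ 4) := by field_simp; ring
  have : 0 < n * α ^ 4 := by positivity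
  nlinarith [mul_le_mul_of_nonneg_right hkm (sq_nonneg γ)]

/-- A single perturbation suffices: samples are then matched independently, each failing with
probability `α`. -/
theorem lower_bound_shift (hk : 2 ≤ k) (hγ : 0 < γ) (hn : 1 ≤ n) (hα : 0 < α)
    (hα2 : α ≤ 1 / 2) (hS : ∀ q : PMF (Fin k), ∃ S : Scheme k n 𝒲, S.Tests γ α q) :
    γ < 8 * α := by
  have : Nonempty (Fin (k / 2)) := ⟨⟨0, by omega⟩⟩
  have hn' : (0 : ℝ) < n := by exact_mod_cast hn
  set z₀ : Fin (k / 2) → Bool := fun _ => true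
  have hp := paninski_nonneg (show 0 ≤ 2 * α by linarith) (by linarith) z₀
  have hone : ∀ t, ∑ x : Fin t → Fin (k / 2) × Bool, ∏ i, paninski (2 * α) z₀ (x i) = 1 :=
    fun t => by simpa [prodE] using prodE_const (sum_paninski (2 * α) z₀) t 1
  have hc : transportCost (fun _ : Unit => paninski (2 * α) z₀) (paninski 0 z₀) (fun _ => 1) n =
      n * α := by
    unfold transportCost
    have e : ∀ t, ∀ x : Fin t → Fin (k / 2) × Bool, (1 / 2) * ∑ y, |∑ _ : Unit,
        1 * (∏ i, paninski (2 * α) z₀ (x i)) * (paninski (2 * α) z₀ y - paninski 0 z₀ y)| =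
        (∏ i, paninski (2 * α) z₀ (x i)) * α := by
      intro t x
      simp only [univ_unique, sum_singleton, one_mul, abs_mul, ← mul_sum]
      rw [sum_abs_paninski_sub (by linarith), abs_of_nonneg (prod_nonneg fun _ _ => hp _)]
      ring
    refine (sum_congr rfl fun t _ => sum_congr rfl fun x _ => e t x).trans ?_
    simp only [← sum_mul, hone]
    simp
  have h := Scheme.Tests.lower_bound_of_embedding hγ.le hS (pairEmbedding_injective k)
    (paninski_nonneg le_rfl zero_le_one z₀) (sum_paninski _ _) (fun _ : Unit => hp)
    (fun _ => sum_paninski _ z₀) (w := fun _ => 1) (fun _ => zero_le_one) (by simp)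
    (fun _ => (sum_abs_paninski_sub (by linarith) z₀ z₀).ge)
    fun F H _ hF1 _ hH1 hFH => prob_add_prob_le_of_far (paninski_nonneg le_rfl zero_le_one _)
      (sum_paninski _ _) (fun _ => hp) (fun _ => sum_paninski _ _) (fun _ => zero_le_one) (by simp)
      (show 0 < γ * n by positivity) hF1 hH1 hFH
  rw [hc] at h
  have h2 : n * α / (γ * n) = α / γ := by field_simp
  rw [h2] at h
  have h3 : 4 / 5 ≤ α / γ := by linarith
  rw [le_div_iff₀ hγ] at h3
  linarith

theorem rpow_quarter_le {x y : ℝ} (hx : 0 ≤ x) (hy : 0 ≤ y) (h : x ≤ y ^ 4) :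
    x ^ (1 / 4 : ℝ) ≤ y := by
  have h1 := Real.rpow_le_rpow hx h (show (0 : ℝ) ≤ 1 / 4 by norm_num)
  rwa [← Real.rpow_natCast, ← Real.rpow_mul hy, show ((4 : ℕ) : ℝ) * (1 / 4) = 1 by norm_num,
    Real.rpow_one] at h1

theorem rateIT_le_of_tests (hk : 2 ≤ k) (hn : 1 ≤ n) (hγ : 0 ≤ γ) (hα : 0 < α)
    (hS : ∀ q : PMF (Fin k), ∃ S : Scheme k n 𝒲, S.Tests γ α q) :
    1 / 32 * rateIT k n γ ≤ α := by
  have hn' : (0 : ℝ) < n := by exact_mod_cast hn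
  -- The perturbations need `2 α ≤ 1`; for larger `α` the cap `1` in the rate is enough. Each of the
  -- four terms is at most `8 α`, whence `1 / 32`.
  by_cases hα2 : α ≤ 1 / 2
  swap
  · have : rateIT k n γ ≤ 1 := min_le_left _ _
    linarith
  have ha : (k : ℝ) ^ (1 / 4 : ℝ) / √(n : ℝ) ≤ 8 * α := by
    rw [div_le_iff₀ (by positivity)]
    refine rpow_quarter_le (by positivity) (by positivity) ?_
    refine (lower_bound_sampling hk hγ hα hα2 hS).le.trans (le_of_eq ?_)
    rw [mul_pow, show √(n : ℝ) ^ 4 = (√(n : ℝ) ^ 2) ^ 2 by ring, Real.sq_sqrt hn'.le]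
    ring
  have hbcd : γ ≤ 8 * α ∧ √(k * γ / n) ≤ 8 * α ∧ (k * γ ^ 2 / n) ^ (1 / 4 : ℝ) ≤ 8 * α := by
    rcases hγ.eq_or_lt with rfl | hγ
    · refine ⟨by linarith, ?_, ?_⟩
      · simp only [mul_zero, zero_div, Real.sqrt_zero]
        linarith
      · refine rpow_quarter_le (by positivity) (by positivity) ?_
        simp only [ne_eq, OfNat.ofNat_ne_zero, not_false_eq_true, zero_pow, mul_zero, zero_div]
        positivity
    · refine ⟨(lower_bound_shift hk hγ hn hα hα2 hS).le, ?_, ?_⟩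
      · rw [Real.sqrt_le_left (by positivity), div_le_iff₀ hn']
        refine (lower_bound_linear hk hγ hn hα hα2 hS).le.trans (le_of_eq (by ring))
      · refine rpow_quarter_le (by positivity) (by positivity) ?_
        rw [div_le_iff₀ hn']
        refine (lower_bound_sqrt hk hγ hn hα hα2 hS).le.trans (le_of_eq (by ring))
  have : rateIT k n γ ≤ _ := min_le_right _ _
  linarith [hbcd.1, hbcd.2.1, hbcd.2.2]

end lower

end LowerBound

/-! ### Binomial expectations as functions of the success probability, and their convexity. -/

section Binomial

open Finset

/-- The expectation of `f` under the binomial distribution with the parameters `n` and `p`. -/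
def binE : ℕ → (ℕ → ℝ) → ℝ → ℝ
  | 0, f, _ => f 0
  | n + 1, f, p => p * binE n (fun j => f (j + 1)) p + (1 - p) * binE n f p

theorem binE_add (n : ℕ) (p : ℝ) : ∀ f g : ℕ → ℝ,
    binE n (fun j => f j + g j) p = binE n f p + binE n g p := by
  induction n with
  | zero => intro f g; rfl
  | succ n ih =>
    intro f g
    simp only [binE]
    rw [ih f g, ih (fun j => f (j + 1)) fun j => g (j + 1)]
    ring

theorem binE_const_mul (n : ℕ) (c p : ℝ) : ∀ f : ℕ → ℝ,
    binE n (fun j => c * f j) p = c * binE n f p := by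
  induction n with
  | zero => intro f; rfl
  | succ n ih =>
    intro f
    simp only [binE]
    rw [ih f, ih fun j => f (j + 1)]
    ring

theorem binE_sub (n : ℕ) (p : ℝ) (f g : ℕ → ℝ) :
    binE n (fun j => f j - g j) p = binE n f p - binE n g p := by
  have h := binE_add n p f fun j => (-1) * g j
  rw [binE_const_mul] at h
  simpa [sub_eq_add_neg] using h

theorem binE_const (n : ℕ) (c p : ℝ) : binE n (fun _ => c) p = c := by
  induction n with
  | zero => rfl
  | succ n ih =>
    simp only [binE, ih]
    ring

theorem binE_mono (n : ℕ) {p : ℝ} (hp : 0 ≤ p) (hp1 : p ≤ 1) : ∀ {f g : ℕ → ℝ},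
    (∀ j, f j ≤ g j) → binE n f p ≤ binE n g p := by
  induction n with
  | zero => intro f g h; exact h 0
  | succ n ih =>
    intro f g h
    exact add_le_add (mul_le_mul_of_nonneg_left (ih fun j => h (j + 1)) hp)
      (mul_le_mul_of_nonneg_left (ih h) (by linarith))

theorem binE_nonneg (n : ℕ) {p : ℝ} (hp : 0 ≤ p) (hp1 : p ≤ 1) {f : ℕ → ℝ} (h : ∀ j, 0 ≤ f j) :
    0 ≤ binE n f p := by
  simpa [binE_const] using binE_mono n hp hp1 h

/-- Differentiation in `p` turns `f` into its forward difference and removes one trial. Applied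
twice, it makes binomial expectations of discretely convex functions convex in `p`. -/
theorem hasDerivAt_binE (n : ℕ) (p : ℝ) : ∀ f : ℕ → ℝ,
    HasDerivAt (binE n f) (n * binE (n - 1) (fun j => f (j + 1) - f j) p) p := by
  induction n with
  | zero =>
    intro f
    simpa [binE] using hasDerivAt_const p (f 0)
  | succ n ih =>
    intro f
    have h1 := (hasDerivAt_id p).mul (ih fun j => f (j + 1))
    have h2 := ((hasDerivAt_const p (1 : ℝ)).sub (hasDerivAt_id p)).mul (ih f)
    refine (h1.add h2).congr_deriv ?_
    simp only [id, Pi.sub_apply, Nat.add_sub_cancel]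
    rw [binE_sub n p (fun j => f (j + 1)) f]
    rcases n with - | n
    · simp
      ring
    · have h3 : binE (n + 1) (fun j => f (j + 1)) p - binE (n + 1) f p =
          p * binE n (fun j => f (j + 1 + 1) - f (j + 1)) p +
            (1 - p) * binE n (fun j => f (j + 1) - f j) p := by
        rw [← binE_sub]
        rfl
      simp only [Nat.add_sub_cancel]
      push_cast
      linear_combination (-(n : ℝ) - 1) * h3

theorem binE_sq (n : ℕ) (p : ℝ) : ∀ a : ℝ,
    binE n (fun j => ((j : ℝ) - a) ^ 2) p = n * p * (1 - p) + (n * p - a) ^ 2 := by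
  induction n with
  | zero => intro a; simp [binE]
  | succ n ih =>
    intro a
    have : (fun j : ℕ => (((j + 1 : ℕ) : ℝ) - a) ^ 2) = fun j : ℕ => ((j : ℝ) - (a - 1)) ^ 2 := by
      funext j
      push_cast
      ring
    simp only [binE]
    rw [this, ih, ih]
    push_cast
    ring

/-- Size biasing of the binomial distribution. -/
theorem binE_nat_mul (n : ℕ) (p : ℝ) : ∀ g : ℕ → ℝ,
    binE n (fun j => j * g j) p = n * p * binE (n - 1) (fun j => g (j + 1)) p := by
  induction n with
  | zero => intro g; simp [binE]
  | succ n ih =>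
    intro g
    have e : (fun j : ℕ => ((j + 1 : ℕ) : ℝ) * g (j + 1)) =
        fun j : ℕ => g (j + 1) + j * g (j + 1) := by
      funext j
      push_cast
      ring
    simp only [binE]
    rw [e, binE_add, ih g, ih fun j => g (j + 1)]
    rcases n with - | n
    · simp
    · simp only [Nat.add_sub_cancel]
      push_cast
      simp only [binE]
      ring

theorem binE_nat (n : ℕ) (p : ℝ) : binE n (fun j => (j : ℝ)) p = n * p := by
  have := binE_nat_mul n p fun _ => 1
  simpa [binE_const] using this

theorem binE_eq_zero (n : ℕ) (p : ℝ) :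
    binE n (fun j => if j = 0 then 1 else 0) p = (1 - p) ^ n := by
  induction n with
  | zero => simp [binE]
  | succ n ih =>
    simp only [binE, Nat.add_eq_zero_iff, one_ne_zero, and_false, if_false, binE_const, ih]
    ring

section taylor

variable {G G' G'' : ℝ → ℝ} {p q κ : ℝ}

theorem deriv_le_of_le_second_deriv (hG' : ∀ t, HasDerivAt G' (G'' t) t) (hpq : p ≤ q)
    (h : ∀ t ∈ Set.Icc p q, κ ≤ G'' t) :
    G' p ≤ G' q - κ * (q - p) := by
  have hm : MonotoneOn (fun t => G' t - κ * t) (Set.Icc p q) := by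
    have hd : ∀ t, HasDerivAt (fun t => G' t - κ * t) (G'' t - κ) t := fun t => by
      refine ((hG' t).sub ((hasDerivAt_id t).const_mul κ)).congr_deriv ?_
      ring
    refine monotoneOn_of_deriv_nonneg (convex_Icc p q)
      (fun t _ => (hd t).continuousAt.continuousWithinAt)
      (fun t _ => (hd t).differentiableAt.differentiableWithinAt) fun t ht => ?_
    rw [interior_Icc] at ht
    rw [(hd t).deriv]
    linarith [h t (Set.Ioo_subset_Icc_self ht)]
  have := hm (Set.left_mem_Icc.2 hpq) (Set.right_mem_Icc.2 hpq) hpq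
  simp only at this
  linarith

theorem taylor_le_of_le_second_deriv (hG : ∀ t, HasDerivAt G (G' t) t)
    (hG' : ∀ t, HasDerivAt G' (G'' t) t) (hpq : p ≤ q) (h : ∀ t ∈ Set.Icc p q, κ ≤ G'' t) :
    κ / 2 * (q - p) ^ 2 ≤ G p - G q - G' q * (p - q) := by
  have hm : AntitoneOn (fun t => G t - G' q * t - κ / 2 * (t - q) ^ 2) (Set.Icc p q) := by
    have hd : ∀ t, HasDerivAt (fun t => G t - G' q * t - κ / 2 * (t - q) ^ 2)
        (G' t - G' q - κ * (t - q)) t := fun t => by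
      have h1 := ((hG t).sub ((hasDerivAt_id t).const_mul (G' q))).sub
        ((((hasDerivAt_id t).sub_const q).pow 2).const_mul (κ / 2))
      refine h1.congr_deriv ?_
      simp
      ring
    refine antitoneOn_of_deriv_nonpos (convex_Icc p q)
      (fun t _ => (hd t).continuousAt.continuousWithinAt)
      (fun t _ => (hd t).differentiableAt.differentiableWithinAt) fun t ht => ?_
    rw [interior_Icc] at ht
    rw [(hd t).deriv]
    have := deriv_le_of_le_second_deriv hG' (κ := κ) ht.2.le fun s hs =>
      h s ⟨ht.1.le.trans hs.1, hs.2⟩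
    linarith
  have := hm (Set.left_mem_Icc.2 hpq) (Set.right_mem_Icc.2 hpq) hpq
  simp only [sub_self] at this
  nlinarith

theorem taylor_nonneg_of_second_deriv_nonneg (hG : ∀ t, HasDerivAt G (G' t) t)
    (hG' : ∀ t, HasDerivAt G' (G'' t) t) (h : ∀ t ∈ Set.uIcc p q, 0 ≤ G'' t) :
    0 ≤ G p - G q - G' q * (p - q) := by
  rcases le_total p q with hpq | hpq
  · rw [Set.uIcc_of_le hpq] at h
    have := taylor_le_of_le_second_deriv hG hG' hpq h
    linarith
  · rw [Set.uIcc_of_ge hpq] at h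
    have h1 : ∀ t, HasDerivAt (fun t => G (-t)) (-G' (-t)) t := fun t => by
      refine ((hG (-t)).comp t (hasDerivAt_neg t)).congr_deriv ?_
      ring
    have h2 : ∀ t, HasDerivAt (fun t => -G' (-t)) (G'' (-t)) t := fun t => by
      refine ((hG' (-t)).comp t (hasDerivAt_neg t)).neg.congr_deriv ?_
      ring
    have := taylor_le_of_le_second_deriv h1 h2 (κ := 0) (neg_le_neg hpq) fun t ht =>
      h (-t) ⟨by linarith [ht.2], by linarith [ht.1]⟩
    simp only [neg_neg] at this
    linarith

/-- Curvature on `[s, q]` alone opens a gap of at least `κ (q - s)` between the slopes at `s` and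
`q`. Convexity on `[p, s]` preserves it, so the error grows linearly in `q - p` beyond the curved
zone. -/
theorem taylor_le_of_le_second_deriv_of_far (hG : ∀ t, HasDerivAt G (G' t) t)
    (hG' : ∀ t, HasDerivAt G' (G'' t) t) {s : ℝ} (hps : p ≤ s) (hsq : s ≤ q) (hκ : 0 ≤ κ)
    (h0 : ∀ t ∈ Set.Icc p s, 0 ≤ G'' t) (h : ∀ t ∈ Set.Icc s q, κ ≤ G'' t) :
    κ / 2 * (q - s) * (q - p) ≤ G p - G q - G' q * (p - q) := by
  have h1 := taylor_le_of_le_second_deriv hG hG' hps h0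
  have h2 := taylor_le_of_le_second_deriv hG hG' hsq h
  have h3 := deriv_le_of_le_second_deriv hG' hsq h
  have h4 := mul_le_mul_of_nonneg_right h3 (show 0 ≤ s - p by linarith)
  have h5 : 0 ≤ κ * (q - s) * (s - p) :=
    mul_nonneg (mul_nonneg hκ (by linarith)) (by linarith)
  nlinarith

end taylor

/-- The error of the linear approximation at `q` of the expectation of `f` under the binomial
distribution with the parameters `n` and `p`. -/
def binBregman (n : ℕ) (f : ℕ → ℝ) (p q : ℝ) : ℝ :=
  binE n f p - binE n f q - n * binE (n - 1) (fun j => f (j + 1) - f j) q * (p - q)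

theorem hasDerivAt_binE_slope (n : ℕ) (f : ℕ → ℝ) (t : ℝ) :
    HasDerivAt (fun t => n * binE (n - 1) (fun j => f (j + 1) - f j) t)
      (n * ((n - 1 : ℕ) * binE (n - 2) (fun j => f (j + 2) - f (j + 1) - (f (j + 1) - f j)) t))
      t :=
  (hasDerivAt_binE (n - 1) t fun j => f (j + 1) - f j).const_mul _

theorem binBregman_nonneg (n : ℕ) {f : ℕ → ℝ}
    (hf : ∀ j, 0 ≤ f (j + 2) - f (j + 1) - (f (j + 1) - f j)) {p q : ℝ} (hp : 0 ≤ p) (hp1 : p ≤ 1)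
    (hq : 0 ≤ q) (hq1 : q ≤ 1) : 0 ≤ binBregman n f p q := by
  refine taylor_nonneg_of_second_deriv_nonneg (fun t => hasDerivAt_binE n t f)
    (hasDerivAt_binE_slope n f) fun t ht => ?_
  have h0 : 0 ≤ t := (le_min hp hq).trans ht.1
  have h1 : t ≤ 1 := ht.2.trans (max_le hp1 hq1)
  have := binE_nonneg (n - 2) h0 h1 hf
  positivity

/-- The number of samples that repeat another one, in a cell with `j` samples. -/
def collisions (j : ℕ) : ℝ := ((j - 1 : ℕ) : ℝ)

theorem collisions_diff (j : ℕ) :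
    collisions (j + 1) - collisions j = if j = 0 then 0 else 1 := by
  rcases j with - | j <;> simp [collisions]

theorem collisions_diff_diff (j : ℕ) :
    collisions (j + 2) - collisions (j + 1) - (collisions (j + 1) - collisions j) =
      if j = 0 then 1 else 0 := by
  rw [collisions_diff (j + 1), collisions_diff j]
  split_ifs <;> simp_all

theorem mul_pred_ge {n : ℕ} (hn : 2 ≤ n) : (n : ℝ) ^ 2 / 2 ≤ n * ((n - 1 : ℕ) : ℝ) := by
  rw [Nat.cast_sub (by omega)]
  have : (2 : ℝ) ≤ n := by exact_mod_cast hn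
  push_cast
  nlinarith

/-- The second difference of `collisions` is the indicator of an empty cell, which has probability
at least `1 / 2` when `n q ≤ 1 / 2`; with `n (n - 1) ≥ n² / 2` the curvature is at least `n² / 4`.
-/
theorem binBregman_collisions_ge {n : ℕ} (hn : 2 ≤ n) {p q : ℝ} (hp : 0 ≤ p) (hpq : p ≤ q)
    (hq : n * q ≤ 1 / 2) : (n * (q - p)) ^ 2 / 8 ≤ binBregman n collisions p q := by
  have hn' : (2 : ℝ) ≤ n := by exact_mod_cast hn
  have h := taylor_le_of_le_second_deriv (fun t => hasDerivAt_binE n t collisions)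
    (hasDerivAt_binE_slope n collisions) hpq (κ := n ^ 2 / 4) fun t ht => by
      simp only [collisions_diff_diff, binE_eq_zero]
      have h1 := one_add_mul_le_pow (show (-2 : ℝ) ≤ -t by nlinarith [ht.2]) (n - 2)
      have h2 : ((n - 2 : ℕ) : ℝ) ≤ n := by exact_mod_cast Nat.sub_le _ _
      have h0 : 0 ≤ t := hp.trans ht.1
      have h3 : ((n - 2 : ℕ) : ℝ) * t ≤ 1 / 2 :=
        (mul_le_mul h2 ht.2 h0 (by positivity)).trans hq
      have h4 : 1 / 2 ≤ (1 - t) ^ (n - 2) := by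
        have : 1 + -t = 1 - t := by ring
        rw [this] at h1
        linarith
      rw [← mul_assoc]
      have h5 := mul_le_mul (mul_pred_ge hn) h4 (by norm_num) (by positivity)
      linarith
  unfold binBregman
  refine le_trans (le_of_eq ?_) h
  ring

/-- The function `j ↦ (j - a) / b`, clamped to the unit interval. -/
def ramp (a b : ℝ) (j : ℕ) : ℝ := max 0 (min 1 ((j - a) / b))

theorem ramp_nonneg (a b : ℝ) (j : ℕ) : 0 ≤ ramp a b j := le_max_left _ _

theorem ramp_le_one (a b : ℝ) (j : ℕ) : ramp a b j ≤ 1 :=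
  max_le zero_le_one (min_le_left _ _)

theorem ramp_mono (a : ℝ) {b : ℝ} (hb : 0 ≤ b) (j : ℕ) : ramp a b j ≤ ramp a b (j + 1) := by
  unfold ramp
  gcongr
  simp

theorem ramp_eq {a b : ℝ} (hb : 0 < b) {j : ℕ} (h : a ≤ j) (h' : j ≤ a + b) :
    ramp a b j = (j - a) / b := by
  unfold ramp
  rw [min_eq_right, max_eq_right]
  · exact div_nonneg (by linarith) hb.le
  · rw [div_le_one hb]
    linarith

/-- A convex function whose slopes are those of `ramp a b`. -/
def smoothHinge (a b : ℝ) (j : ℕ) : ℝ := ∑ i ∈ range j, ramp a b i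

theorem smoothHinge_diff (a b : ℝ) (j : ℕ) :
    smoothHinge a b (j + 1) - smoothHinge a b j = ramp a b j := by
  simp [smoothHinge, sum_range_succ]

/-- A quadratic minorant, so that the expected second difference is controlled by the second moment
of the count alone. The window has half-width `6 l` but `5 l` is used: as `1 ≤ l`, both `j` and `j +
1` then lie on the slope. -/
theorem ramp_diff_ge {l x : ℝ} (hl : 1 ≤ l) (j : ℕ) :
    1 / (12 * l) * (1 - (j - x) ^ 2 / (25 * l ^ 2)) ≤
      ramp (x - 6 * l) (12 * l) (j + 1) - ramp (x - 6 * l) (12 * l) j := by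
  by_cases h : |(j : ℝ) - x| ≤ 5 * l
  · rw [abs_le] at h
    rw [ramp_eq (by positivity) (by push_cast; linarith) (by push_cast; linarith),
      ramp_eq (by positivity) (by linarith) (by linarith)]
    push_cast
    have e : ((j : ℝ) + 1 - (x - 6 * l)) / (12 * l) - (j - (x - 6 * l)) / (12 * l) =
        1 / (12 * l) * 1 := by ring
    rw [e]
    refine mul_le_mul_of_nonneg_left ?_ (by positivity)
    have : 0 ≤ ((j : ℝ) - x) ^ 2 / (25 * l ^ 2) := by positivity
    linarith
  · push Not at h
    refine le_trans ?_ (sub_nonneg.2 (ramp_mono _ (by positivity) j))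
    refine mul_nonpos_of_nonneg_of_nonpos (by positivity) ?_
    rw [sub_nonpos, one_le_div (by positivity), ← sq_abs ((j : ℝ) - x)]
    nlinarith

/-- As long as `n (q - t) ≤ l`, the count under `t` mostly stays in the window where the hinge
bends, so the curvature is of order `n² / l`. Within that range the gain is quadratic, beyond it
linear. -/
theorem binBregman_smoothHinge_ge {n : ℕ} (hn : 2 ≤ n) {p q l : ℝ} (hp : 0 ≤ p) (hpq : p ≤ q)
    (hq1 : q ≤ 1) (hl : 1 ≤ l) (hq : n * q ≤ l ^ 2 / 2) :
    1 / 80 * min ((n * (q - p)) ^ 2 / l) (n * (q - p)) ≤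
      binBregman n (smoothHinge (n * q - 6 * l) (12 * l)) p q := by
  have hn' : (2 : ℝ) ≤ n := by exact_mod_cast hn
  set f := smoothHinge (n * q - 6 * l) (12 * l) with hf
  have hdiff : ∀ j, f (j + 2) - f (j + 1) - (f (j + 1) - f j) =
      ramp (n * q - 6 * l) (12 * l) (j + 1) - ramp (n * q - 6 * l) (12 * l) j := fun j => by
    rw [hf, show j + 2 = (j + 1) + 1 by ring, smoothHinge_diff, smoothHinge_diff]
  have hnn : ∀ t ∈ Set.Icc p q, 0 ≤ (n : ℝ) * ((n - 1 : ℕ) *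
      binE (n - 2) (fun j => f (j + 2) - f (j + 1) - (f (j + 1) - f j)) t) := fun t ht => by
    have := binE_nonneg (n - 2) (hp.trans ht.1) (ht.2.trans hq1) (f := fun j =>
      f (j + 2) - f (j + 1) - (f (j + 1) - f j)) fun j => by
        rw [hdiff]
        exact sub_nonneg.2 (ramp_mono _ (by positivity) j)
    positivity
  have hκ : ∀ t ∈ Set.Icc p q, n * (q - t) ≤ l → (n : ℝ) ^ 2 / (40 * l) ≤ n * ((n - 1 : ℕ) *
      binE (n - 2) (fun j => f (j + 2) - f (j + 1) - (f (j + 1) - f j)) t) := fun t ht htl => by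
    have h0 : 0 ≤ t := hp.trans ht.1
    have h1 : t ≤ 1 := ht.2.trans hq1
    have hbin : 1 / (20 * l) ≤
        binE (n - 2) (fun j => f (j + 2) - f (j + 1) - (f (j + 1) - f j)) t := by
      calc 1 / (20 * l) ≤ 1 / (12 * l) * (1 - (((n - 2 : ℕ) : ℝ) * t * (1 - t) +
            (((n - 2 : ℕ) : ℝ) * t - n * q) ^ 2) / (25 * l ^ 2)) := by
            rw [Nat.cast_sub hn]
            push_cast
            have h2 : ((n : ℝ) - 2) * t * (1 - t) ≤ l ^ 2 / 2 := by
              have : ((n : ℝ) - 2) * t * (1 - t) ≤ n * q := by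
                have h3 : ((n : ℝ) - 2) * t ≤ n * q :=
                  mul_le_mul (by linarith) ht.2 h0 (by positivity)
                have h4 : 0 ≤ ((n : ℝ) - 2) * t := mul_nonneg (by linarith) h0
                nlinarith
              linarith
            -- The shift is at most `l` from `n (q - t)` and `2 t ≤ 2 l` from the two removed
            -- trials. With variance at most `l² / 2` the second moment is below `10 l²`, that is `2
            -- / 5` of `25 l²`.
            have h3 : (((n : ℝ) - 2) * t - n * q) ^ 2 ≤ 9 * l ^ 2 := by
              have h4 : -(3 * l) ≤ ((n : ℝ) - 2) * t - n * q := by nlinarith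
              have h5 : ((n : ℝ) - 2) * t - n * q ≤ 3 * l := by
                have : n * t ≤ n * q := mul_le_mul_of_nonneg_left ht.2 (by positivity)
                linarith
              nlinarith
            have h6 : (((n : ℝ) - 2) * t * (1 - t) + (((n : ℝ) - 2) * t - n * q) ^ 2) /
                (25 * l ^ 2) ≤ 2 / 5 := by
              rw [div_le_iff₀ (by positivity)]
              nlinarith
            have h7 : 1 / (20 * l) = 1 / (12 * l) * (1 - 2 / 5) := by
              field_simp
              norm_num
            rw [h7]
            exact mul_le_mul_of_nonneg_left (by linarith) (by positivity)
        _ = binE (n - 2) (fun j => 1 / (12 * l) * (1 - (1 / (25 * l ^ 2)) *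
            ((j : ℝ) - n * q) ^ 2)) t := by
            rw [binE_const_mul, binE_sub, binE_const, binE_const_mul, binE_sq]
            ring
        _ ≤ _ := by
            refine binE_mono _ h0 h1 fun j => ?_
            rw [hdiff]
            refine le_trans (le_of_eq ?_) (ramp_diff_ge hl j)
            ring
    rw [← mul_assoc]
    calc (n : ℝ) ^ 2 / (40 * l) = n ^ 2 / 2 * (1 / (20 * l)) := by field_simp; norm_num
      _ ≤ _ := mul_le_mul (mul_pred_ge hn) hbin (by positivity) (by positivity)
  rcases le_total (n * (q - p)) l with h | h
  · have := taylor_le_of_le_second_deriv (fun t => hasDerivAt_binE n t f)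
      (hasDerivAt_binE_slope n f) hpq (κ := n ^ 2 / (40 * l)) fun t ht => hκ t ht
        ((mul_le_mul_of_nonneg_left (by linarith [ht.1]) (by positivity)).trans h)
    refine le_trans ?_ this
    refine (mul_le_mul_of_nonneg_left (min_le_left _ _) (by norm_num)).trans (le_of_eq ?_)
    field_simp
    ring
  -- Only the last stretch of length `l / n` before `q` is known to be curved.
  · have hs : p ≤ q - l / n := by
      have : l / n ≤ q - p := by
        rw [div_le_iff₀ (by positivity)]
        linarith
      linarith
    have hln : 0 ≤ l / n := by positivity
    have := taylor_le_of_le_second_deriv_of_far (fun t => hasDerivAt_binE n t f)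
      (hasDerivAt_binE_slope n f) hs (by linarith) (κ := n ^ 2 / (40 * l)) (by positivity)
      (fun t ht => hnn t ⟨ht.1, by linarith [ht.2]⟩) fun t ht => hκ t ⟨hs.trans ht.1, ht.2⟩ (by
        calc n * (q - t) ≤ n * (l / n) :=
              mul_le_mul_of_nonneg_left (by linarith [ht.1]) (by positivity)
          _ = l := by field_simp)
    refine le_trans ?_ this
    refine (mul_le_mul_of_nonneg_left (min_le_right _ _) (by norm_num)).trans (le_of_eq ?_)
    field_simp
    ring

end Binomial

/-! ### The test statistic: stability, mean and variance. -/

section Statistic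

open Finset

section counts

variable {A : Type*} [DecidableEq A]

/-- The number of occurrences of each letter in the sample `x`. -/
def counts {n : ℕ} (x : Fin n → A) : A → ℕ := ∑ i, Pi.single (x i) 1

theorem counts_cons {n : ℕ} (a : A) (x : Fin n → A) :
    counts (Fin.cons a x : Fin (n + 1) → A) = counts x + Pi.single a 1 := by
  simp [counts, Fin.sum_univ_succ, add_comm]

/-- Replacing a sample removes one letter and adds another, hence the factor 2. The offset `M`
carries the common part of the counts through the induction. -/
theorem abs_sub_counts_le {Φ : (A → ℕ) → ℝ} (hΦ : ∀ a N, |Φ (N + Pi.single a 1) - Φ N| ≤ 1)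
    {n : ℕ} : ∀ (M : A → ℕ) (x x' : Fin n → A),
    |Φ (M + counts x) - Φ (M + counts x')| ≤ 2 * hammingDist x x' := by
  induction n with
  | zero =>
    intro M x x'
    rw [Subsingleton.elim x x']
    simp
  | succ n ih =>
    intro M x x'
    rw [← Fin.cons_self_tail x, ← Fin.cons_self_tail x']
    set a := x 0
    set b := x' 0
    set y := Fin.tail x
    set y' := Fin.tail x'
    rw [hammingDist_cons, counts_cons, counts_cons, ← add_assoc, ← add_assoc]
    by_cases hab : a = b
    · have := ih (M + Pi.single b 1) y y'
      rw [add_right_comm, add_right_comm M (Pi.single b 1) (counts y')] at this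
      simpa [hab] using this
    · have h1 := hΦ a (M + counts y)
      have h2 := hΦ b (M + counts y')
      have h3 := ih M y y'
      rw [if_neg hab]
      push_cast
      rw [abs_le] at *
      constructor <;> linarith [h1.1, h1.2, h2.1, h2.2, h3.1, h3.2]

variable [Fintype A]

/-- The expectation of a function of the counts of `n` independent samples. -/
def countE (w : A → ℝ) (n : ℕ) (Φ : (A → ℕ) → ℝ) : ℝ := prodE w n fun x => Φ (counts x)

variable {w : A → ℝ}

theorem countE_zero (Φ : (A → ℕ) → ℝ) : countE w 0 Φ = Φ 0 := by
  simp [countE, prodE_zero, counts]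

theorem countE_succ (n : ℕ) (Φ : (A → ℕ) → ℝ) :
    countE w (n + 1) Φ = ∑ a, w a * countE w n fun N => Φ (N + Pi.single a 1) := by
  simp [countE, prodE_succ, counts_cons]

theorem countE_succ' (n : ℕ) (Φ : (A → ℕ) → ℝ) :
    countE w (n + 1) Φ = countE w n fun N => ∑ a, w a * Φ (N + Pi.single a 1) := by
  rw [countE_succ, countE, prodE_sum]
  exact sum_congr rfl fun a _ => (prodE_const_mul _ _ _ _).symm

theorem countE_apply (hw1 : ∑ a, w a = 1) (a : A) (n : ℕ) : ∀ g : ℕ → ℝ,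
    countE w n (fun N => g (N a)) = binE n g (w a) := by
  induction n with
  | zero => intro g; simp [countE_zero, binE]
  | succ n ih =>
    intro g
    rw [countE_succ, ← add_sum_erase _ _ (mem_univ a)]
    have h1 : ∀ b ∈ univ.erase a, w b * countE w n (fun N : A → ℕ => g ((N + Pi.single b 1 : A → ℕ) a)) =
        w b * binE n g (w a) := by
      intro b hb
      have : a ≠ b := (ne_of_mem_erase hb).symm
      simp [this, ih]
    rw [sum_congr rfl h1, ← sum_mul, sum_erase_eq_sub (mem_univ a), hw1]
    simp [binE, ih fun j => g (j + 1)]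

/-- The Efron–Stein inequality for functions of the counts. -/
theorem efron_stein (hw : ∀ a, 0 ≤ w a) (hw1 : ∑ a, w a = 1) (n : ℕ) : ∀ Φ : (A → ℕ) → ℝ,
    countE w n (fun N => Φ N ^ 2) - countE w n Φ ^ 2 ≤
      n * ∑ a, w a * countE w (n - 1) fun N => (Φ (N + Pi.single a 1) - Φ N) ^ 2 := by
  induction n with
  | zero => intro Φ; simp [countE_zero]
  | succ n ih =>
    intro Φ
    set Ψ : (A → ℕ) → ℝ := fun N => ∑ a, w a * Φ (N + Pi.single a 1) with hΨ
    have hjensen : ∀ g : A → ℝ, (∑ a, w a * g a) ^ 2 ≤ ∑ a, w a * g a ^ 2 := by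
      intro g
      have := sum_mul_sq_le_sq_mul_sq univ (fun a => √(w a)) fun a => √(w a) * g a
      simp only [← mul_assoc, mul_pow, Real.mul_self_sqrt (hw _), Real.sq_sqrt (hw _), hw1,
        one_mul] at this
      exact this
    -- The variance over the last sample is at most the second moment around any centre; the centre
    -- `Φ N` compares with leaving the sample out. The remaining variance is that of `Ψ`, whose
    -- increments Jensen bounds by those of `Φ`.
    have h1 : ∀ N, ∑ a, w a * Φ (N + Pi.single a 1) ^ 2 ≤
        Ψ N ^ 2 + ∑ a, w a * (Φ (N + Pi.single a 1) - Φ N) ^ 2 := by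
      intro N
      have e : ∑ a, w a * (Φ (N + Pi.single a 1) - Φ N) ^ 2 =
          ∑ a, w a * Φ (N + Pi.single a 1) ^ 2 - 2 * Φ N * Ψ N + Φ N ^ 2 := by
        have : ∀ a, w a * (Φ (N + Pi.single a 1) - Φ N) ^ 2 = w a * Φ (N + Pi.single a 1) ^ 2 -
            2 * Φ N * (w a * Φ (N + Pi.single a 1)) + w a * Φ N ^ 2 := fun a => by ring
        simp only [this, sum_add_distrib, sum_sub_distrib, ← mul_sum, ← sum_mul, hw1, one_mul, hΨ]
      rw [e]
      nlinarith [sq_nonneg (Ψ N - Φ N)]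
    have h2 : countE w (n + 1) (fun N => Φ N ^ 2) ≤ countE w n (fun N => Ψ N ^ 2) +
        ∑ a, w a * countE w n fun N => (Φ (N + Pi.single a 1) - Φ N) ^ 2 := by
      rw [countE_succ']
      refine (prodE_mono hw fun x => h1 (counts x)).trans (le_of_eq ?_)
      rw [prodE_add, prodE_sum]
      congr 1
      exact sum_congr rfl fun a _ => prodE_const_mul _ _ _ _
    have h3 : countE w (n + 1) Φ = countE w n Ψ := countE_succ' n Φ
    have h4 := ih Ψ
    have h5 : n * ∑ b, w b * countE w (n - 1) (fun N => (Ψ (N + Pi.single b 1) - Ψ N) ^ 2) ≤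
        n * ∑ b, w b * countE w n fun N => (Φ (N + Pi.single b 1) - Φ N) ^ 2 := by
      rcases n with - | n
      · simp
      refine mul_le_mul_of_nonneg_left (sum_le_sum fun b _ =>
        mul_le_mul_of_nonneg_left ?_ (hw b)) (by positivity)
      rw [countE_succ']
      refine prodE_mono hw fun x => ?_
      have e : Ψ (counts x + Pi.single b 1) - Ψ (counts x) = ∑ a, w a *
          (Φ (counts x + Pi.single a 1 + Pi.single b 1) - Φ (counts x + Pi.single a 1)) := by
        simp only [hΨ, mul_sub, sum_sub_distrib]
        congr 1
        exact sum_congr rfl fun a _ => by rw [add_right_comm]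
      simp only at e ⊢
      rw [e]
      exact hjensen _
    rw [h3]
    push_cast
    linarith

end counts

section weights

variable {A : Type*} [Fintype A] {w : A → ℝ}

theorem one_sub_le_prodE_of_variance (hw : ∀ a, 0 ≤ w a) (hw1 : ∑ a, w a = 1) {n : ℕ}
    {F : (Fin n → A) → ℝ} {V t : ℝ} (ht : 0 < t)
    (hV : prodE w n (fun x => F x ^ 2) - prodE w n F ^ 2 ≤ V) (Q : (Fin n → A) → Prop)
    [DecidablePred Q] (hQ : ∀ x, |F x - prodE w n F| < t → Q x) :
    1 - V / t ^ 2 ≤ prodE w n fun x => if Q x then 1 else 0 := by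
  set m := prodE w n F with hm
  have h1 : ∀ x, 1 + (-1 / t ^ 2 * F x ^ 2 + (2 * m / t ^ 2 * F x + -m ^ 2 / t ^ 2)) ≤
      if Q x then 1 else 0 := by
    intro x
    have e : 1 + (-1 / t ^ 2 * F x ^ 2 + (2 * m / t ^ 2 * F x + -m ^ 2 / t ^ 2)) =
        1 - (F x - m) ^ 2 / t ^ 2 := by ring
    rw [e]
    split_ifs with h
    · have : 0 ≤ (F x - m) ^ 2 / t ^ 2 := by positivity
      linarith
    · have h2 : t ≤ |F x - m| := not_lt.1 fun h3 => h (hQ x h3)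
      rw [sub_nonpos, one_le_div (by positivity), ← sq_abs (F x - m)]
      exact pow_le_pow_left₀ ht.le h2 2
  refine le_trans ?_ (prodE_mono hw h1)
  rw [prodE_add, prodE_add, prodE_add, prodE_const hw1, prodE_const hw1, prodE_const_mul,
    prodE_const_mul, ← hm]
  have h2 : V / t ^ 2 ≥ (prodE w n (fun x => F x ^ 2) - m ^ 2) / t ^ 2 :=
    div_le_div_of_nonneg_right hV (by positivity)
  have e : 1 + (-1 / t ^ 2 * prodE w n (fun x => F x ^ 2) + (2 * m / t ^ 2 * m + -m ^ 2 / t ^ 2)) =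
      1 - (prodE w n (fun x => F x ^ 2) - m ^ 2) / t ^ 2 := by ring
  rw [e]
  linarith

theorem le_one_of_sum_eq_one {p : A → ℝ} (hp : ∀ a, 0 ≤ p a) (hp1 : ∑ a, p a = 1) (a : A) :
    p a ≤ 1 :=
  hp1 ▸ single_le_sum (fun b _ => hp b) (mem_univ a)

/-- Only cells with `p a ≤ q a` are needed: the positive parts of `q - p` sum to the total variation
distance. For `t ≤ 1`, `min (u² / l) u ≥ t u - t² l / 4`, which is linear in `u` and can be summed;
`htl` makes the subtracted total at most half of the main term. -/
theorem sum_bregman_ge {k : ℕ} (hcard : Fintype.card A ≤ 3 * k) {p q : A → ℝ}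
    (hpq : ∑ a, p a = ∑ a, q a) {B : A → ℝ} {s α l t : ℝ} (hs : 0 ≤ s) (hl : 0 < l) (ht : 0 ≤ t)
    (ht1 : t ≤ 1) (htl : t * (3 * k * l) ≤ 2 * (s * α)) (hB : ∀ a, 0 ≤ B a)
    (hB' : ∀ a, p a ≤ q a → 1 / 80 * min ((s * (q a - p a)) ^ 2 / l) (s * (q a - p a)) ≤ B a)
    (hα : 2 * α ≤ ∑ a, |p a - q a|) : t * (s * α) / 160 ≤ ∑ a, B a := by
  have h1 : ∀ a, 1 / 80 * (t * s * ((|p a - q a| + (q a - p a)) / 2) - t ^ 2 * l / 4) ≤ B a := by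
    intro a
    rcases le_total (p a) (q a) with h | h
    · refine le_trans (mul_le_mul_of_nonneg_left ?_ (by norm_num)) (hB' a h)
      rw [abs_of_nonpos (by linarith)]
      have e : (-(p a - q a) + (q a - p a)) / 2 = q a - p a := by ring
      rw [e, mul_assoc]
      have hu : 0 ≤ s * (q a - p a) := mul_nonneg hs (by linarith)
      set u := s * (q a - p a)
      refine le_min ?_ ?_
      · rw [le_div_iff₀ hl]
        nlinarith [sq_nonneg (u - t * l / 2)]
      · have : 0 ≤ t ^ 2 * l / 4 := by positivity
        nlinarith
    · rw [abs_of_nonneg (by linarith)]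
      have : 0 ≤ t ^ 2 * l / 4 := by positivity
      refine le_trans ?_ (hB a)
      have e : (p a - q a + (q a - p a)) / 2 = 0 := by ring
      rw [e]
      linarith
  refine le_trans ?_ (sum_le_sum fun a _ => h1 a)
  rw [← mul_sum, sum_sub_distrib, ← mul_sum, ← sum_div, sum_add_distrib, sum_sub_distrib, hpq,
    sub_self, add_zero, sum_const, card_univ, nsmul_eq_mul]
  have hc : (Fintype.card A : ℝ) ≤ 3 * k := by exact_mod_cast hcard
  have h2 : (Fintype.card A : ℝ) * (t ^ 2 * l / 4) ≤ 3 * k * (t ^ 2 * l / 4) :=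
    mul_le_mul_of_nonneg_right hc (by positivity)
  have h3 : t * s * α ≤ t * s * ((∑ a, |p a - q a|) / 2) :=
    mul_le_mul_of_nonneg_left (by linarith) (by positivity)
  have h4 := mul_le_mul_of_nonneg_left htl ht
  nlinarith

end weights

section statistic

variable {A : Type*} [Fintype A] {n : ℕ} (f : A → ℕ → ℝ) (q : A → ℝ)

/-- The slope at `q` of the expectation of `f` under binomial distributions. -/
def binSlope (n : ℕ) (f : ℕ → ℝ) (q : ℝ) : ℝ := binE (n - 1) (fun j => f (j + 1) - f j) q

/-- The test statistic: the sum of `f a` at the number of occurrences of `a`, corrected so that the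
expectation is zero and stationary at `q`. -/
def testStat (n : ℕ) (N : A → ℕ) : ℝ :=
  ∑ a, (f a (N a) - binSlope n (f a) (q a) * N a) -
    ∑ a, (binE n (f a) (q a) - binSlope n (f a) (q a) * (n * q a))

/-- The Efron–Stein bound for the variance of the test statistic under `p`. -/
def statVariance (n : ℕ) (p : A → ℝ) : ℝ :=
  n * ∑ a, p a *
    binE (n - 1) (fun j => (f a (j + 1) - f a j - binSlope n (f a) (q a)) ^ 2) (p a)

variable {f q}

theorem binSlope_mem_Icc {f : ℕ → ℝ} (h0 : ∀ j, 0 ≤ f (j + 1) - f j)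
    (h1 : ∀ j, f (j + 1) - f j ≤ 1) {q : ℝ} (hq : 0 ≤ q) (hq1 : q ≤ 1) :
    0 ≤ binSlope n f q ∧ binSlope n f q ≤ 1 :=
  ⟨binE_nonneg _ hq hq1 h0, (binE_mono _ hq hq1 h1).trans (binE_const _ _ _).le⟩

theorem statVariance_le (h0 : ∀ a j, 0 ≤ f a (j + 1) - f a j)
    (h1 : ∀ a j, f a (j + 1) - f a j ≤ 1) (hq : ∀ a, 0 ≤ q a) (hq1 : ∑ a, q a = 1) {p : A → ℝ}
    (hp : ∀ a, 0 ≤ p a) (hp1 : ∑ a, p a = 1) : statVariance f q n p ≤ n := by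
  unfold statVariance
  have : ∑ a, p a * binE (n - 1)
      (fun j => (f a (j + 1) - f a j - binSlope n (f a) (q a)) ^ 2) (p a) ≤ ∑ a, p a * 1 := by
    refine sum_le_sum fun a _ => mul_le_mul_of_nonneg_left ?_ (hp a)
    refine (binE_mono _ (hp a) (le_one_of_sum_eq_one hp hp1 a) fun j => ?_).trans
      (binE_const _ 1 _).le
    have h := binSlope_mem_Icc (n := n) (h0 a) (h1 a) (hq a) (le_one_of_sum_eq_one hq hq1 a)
    rw [sq_le_one_iff_abs_le_one, abs_le]
    constructor <;> linarith [h0 a j, h1 a j, h.1, h.2]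
  simp only [mul_one, hp1] at this
  nlinarith [show (0 : ℝ) ≤ n by positivity]

/-- Size biasing turns the middle quantity into the expectation of `j` restricted to `j ≥ 2`, and
there `j - 1 ≤ j ≤ 2 (j - 1)`. -/
theorem binE_collisions_le {p : ℝ} (hp : 0 ≤ p) (hp1 : p ≤ 1) :
    binE n collisions p ≤ n * p * binSlope n collisions p ∧
      n * p * binSlope n collisions p ≤ 2 * binE n collisions p := by
  have e : binE n (fun j => j * if j ≤ 1 then (0 : ℝ) else 1) p =
      n * p * binSlope n collisions p := by
    rw [binE_nat_mul, binSlope]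
    congr 2
    funext j
    rw [collisions_diff]
    simp
  rw [← e, ← binE_const_mul]
  refine ⟨binE_mono n hp hp1 fun j => ?_, binE_mono n hp hp1 fun j => ?_⟩
  · rcases j with - | - | j <;> simp [collisions]
  · rcases j with - | - | j <;> simp [collisions]
    linarith

theorem binSlope_collisions_le {p : ℝ} (hp : 0 ≤ p) (hp1 : p ≤ 1) :
    binSlope n collisions p ≤ n * p := by
  unfold binSlope
  refine (binE_mono _ hp hp1 (g := fun j => (j : ℝ)) fun j => ?_).trans ?_
  · rw [collisions_diff]
    rcases j with - | j <;> simp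
  · rw [binE_nat]
    have : ((n - 1 : ℕ) : ℝ) ≤ n := by exact_mod_cast Nat.sub_le _ _
    exact mul_le_mul_of_nonneg_right this hp

/-- Expected repetitions under `p` control the variance, and they are the Bregman error plus a
linear term of size `n² b p a`. For small `b` the variance is therefore governed by the mean itself,
as for a Poisson count. -/
theorem statVariance_collisions_le {b : ℝ} (hb : n * b ≤ 1) (hq : ∀ a, 0 ≤ q a)
    (hqb : ∀ a, q a ≤ b) (hq1 : ∑ a, q a = 1) {p : A → ℝ} (hp : ∀ a, 0 ≤ p a)
    (hp1 : ∑ a, p a = 1) :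
    statVariance (fun _ => collisions) q n p ≤
      2 * ∑ a, binBregman n collisions (p a) (q a) + 5 * n ^ 2 * b := by
  have hb0 : 0 ≤ b := by
    by_contra hcon
    push Not at hcon
    have : ∑ a, q a ≤ 0 := sum_nonpos fun a _ => (hqb a).trans hcon.le
    linarith
  have hn : (0 : ℝ) ≤ n := by positivity
  set c : A → ℝ := fun a => binSlope n collisions (q a)
  have hc0 : ∀ a, 0 ≤ c a := fun a =>
    binE_nonneg _ (hq a) (le_one_of_sum_eq_one hq hq1 a) fun j => by
      rw [collisions_diff]; split_ifs <;> norm_num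
  have hcb : ∀ a, c a ≤ n * b := fun a =>
    (binSlope_collisions_le (hq a) (le_one_of_sum_eq_one hq hq1 a)).trans
      (mul_le_mul_of_nonneg_left (hqb a) hn)
  have h1 : ∀ a, n * (p a * binE (n - 1)
      (fun j => (collisions (j + 1) - collisions j - c a) ^ 2) (p a)) ≤
      2 * binBregman n collisions (p a) (q a) + (2 * n ^ 2 * b) * q a +
        (3 * n ^ 2 * b) * p a := by
    intro a
    have hpa := le_one_of_sum_eq_one hp hp1 a
    have hqa := le_one_of_sum_eq_one hq hq1 a
    have h2 : binE (n - 1) (fun j => (collisions (j + 1) - collisions j - c a) ^ 2) (p a) ≤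
        binSlope n collisions (p a) + c a ^ 2 := by
      rw [binSlope, ← binE_const (n - 1) (c a ^ 2) (p a), ← binE_add]
      refine binE_mono _ (hp a) hpa fun j => ?_
      rw [collisions_diff]
      split_ifs
      · simp
      · nlinarith [hc0 a]
    have h3 := (binE_collisions_le (n := n) (hp a) hpa).2
    have h4 := (binE_collisions_le (n := n) (hq a) hqa).1
    have h5 : c a ^ 2 ≤ n * b := by nlinarith [hc0 a, hcb a]
    have h6 : n * q a * c a ≤ n * q a * (n * b) :=
      mul_le_mul_of_nonneg_left (hcb a) (mul_nonneg hn (hq a))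
    have h7 : n * p a * c a ≤ n * p a * (n * b) :=
      mul_le_mul_of_nonneg_left (hcb a) (mul_nonneg hn (hp a))
    have h8 : n * p a * c a ^ 2 ≤ n * p a * (n * b) :=
      mul_le_mul_of_nonneg_left h5 (mul_nonneg hn (hp a))
    have h9 : binBregman n collisions (p a) (q a) = binE n collisions (p a) -
      binE n collisions (q a) - n * c a * (p a - q a) := rfl
    have h10 := mul_le_mul_of_nonneg_left h2 (mul_nonneg hn (hp a))
    have h11 : 0 ≤ n * q a * c a := mul_nonneg (mul_nonneg hn (hq a)) (hc0 a)
    change n * q a * c a ≥ _ at h4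
    nlinarith
  unfold statVariance
  rw [mul_sum]
  refine (sum_le_sum fun a _ => h1 a).trans (le_of_eq ?_)
  rw [sum_add_distrib, sum_add_distrib, ← mul_sum, ← mul_sum, ← mul_sum, hp1, hq1]
  ring

variable [DecidableEq A] (f q)

theorem testStat_add_single (N : A → ℕ) (a : A) :
    testStat f q n (N + Pi.single a 1) - testStat f q n N =
      f a (N a + 1) - f a (N a) - binSlope n (f a) (q a) := by
  unfold testStat
  rw [sub_sub_sub_cancel_right, ← sum_sub_distrib, sum_eq_single a]
  · simp
    ring
  · intro b _ hb
    simp [hb]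
  · simp

variable {f q}

theorem countE_testStat {p : A → ℝ} (hp1 : ∑ a, p a = 1) :
    countE p n (testStat f q n) = ∑ a, binBregman n (f a) (p a) (q a) := by
  have h1 : ∀ a, prodE p n (fun x => f a (counts x a) - binSlope n (f a) (q a) * counts x a) =
      binE n (f a) (p a) - binSlope n (f a) (q a) * (n * p a) := by
    intro a
    have := countE_apply hp1 a n fun j => f a j - binSlope n (f a) (q a) * j
    rw [binE_sub, binE_const_mul, binE_nat] at this
    exact this
  have h2 : countE p n (testStat f q n) = ∑ a, prodE p n (fun x => f a (counts x a) -
      binSlope n (f a) (q a) * counts x a) -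
        ∑ a, (binE n (f a) (q a) - binSlope n (f a) (q a) * (n * q a)) := by
    simp only [countE, testStat, sub_eq_add_neg (∑ a, (f a _ - _)) _]
    rw [prodE_add, prodE_const hp1, prodE_sum, sub_eq_add_neg]
  rw [h2, ← sum_sub_distrib]
  refine sum_congr rfl fun a _ => ?_
  rw [h1, binBregman, binSlope]
  ring

theorem variance_testStat_le {p : A → ℝ} (hp : ∀ a, 0 ≤ p a) (hp1 : ∑ a, p a = 1) :
    countE p n (fun N => testStat f q n N ^ 2) - countE p n (testStat f q n) ^ 2 ≤
      statVariance f q n p := by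
  refine (efron_stein hp hp1 n _).trans (le_of_eq ?_)
  unfold statVariance
  congr 1
  refine sum_congr rfl fun a _ => ?_
  simp only [testStat_add_single]
  rw [countE_apply hp1 a (n - 1) fun j => (f a (j + 1) - f a j - binSlope n (f a) (q a)) ^ 2]

theorem abs_testStat_counts_sub_le (h0 : ∀ a j, 0 ≤ f a (j + 1) - f a j)
    (h1 : ∀ a j, f a (j + 1) - f a j ≤ 1) (hq : ∀ a, 0 ≤ q a) (hq1 : ∑ a, q a = 1)
    (x x' : Fin n → A) :
    |testStat f q n (counts x) - testStat f q n (counts x')| ≤ 2 * hammingDist x x' := by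
  have := abs_sub_counts_le (Φ := testStat f q n) (fun a N => by
    rw [testStat_add_single]
    have h := binSlope_mem_Icc (n := n) (h0 a) (h1 a) (hq a) (le_one_of_sum_eq_one hq hq1 a)
    rw [abs_le]
    constructor <;> linarith [h0 a (N a), h1 a (N a), h.1, h.2]) 0 x x'
  simpa using this

/-- A quarter of `D` is left for random fluctuation and a quarter for the corruption, on each side
of the threshold `D / 2`; Chebyshev fails with probability at most `1 / 16`. -/
theorem accept_prob_ge (hq : ∀ a, 0 ≤ q a) (hq1 : ∑ a, q a = 1) {D r : ℝ} (hD : 0 < D)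
    (hr : 2 * r ≤ D / 4) (hV : statVariance f q n q ≤ D ^ 2 / 256) :
    15 / 16 ≤ prodE q n fun x =>
      if testStat f q n (counts x) + 2 * r < D / 2 then 1 else 0 := by
  have hm : prodE q n (fun x => testStat f q n (counts x)) = 0 := by
    refine (countE_testStat hq1).trans (sum_eq_zero fun a _ => ?_)
    simp [binBregman]
  have h := one_sub_le_prodE_of_variance hq hq1 (t := D / 4) (by positivity)
    ((variance_testStat_le (f := f) (q := q) hq hq1).trans hV)
    (fun x => testStat f q n (counts x) + 2 * r < D / 2) fun x hx => by
      rw [hm, sub_zero, abs_lt] at hx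
      linarith [hx.2]
  refine le_trans (le_of_eq ?_) h
  field_simp
  norm_num

theorem reject_prob_ge {p : A → ℝ} (hp : ∀ a, 0 ≤ p a) (hp1 : ∑ a, p a = 1) {D r : ℝ} (hD : 0 < D)
    (hr : 2 * r ≤ D / 4) (hm : D ≤ ∑ a, binBregman n (f a) (p a) (q a))
    (hV : statVariance f q n p ≤ (∑ a, binBregman n (f a) (p a) (q a)) ^ 2 / 256) :
    15 / 16 ≤ prodE p n fun x =>
      if D / 2 ≤ testStat f q n (counts x) - 2 * r then 1 else 0 := by
  have hmean : prodE p n (fun x => testStat f q n (counts x)) =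
    ∑ a, binBregman n (f a) (p a) (q a) := countE_testStat hp1
  set m := ∑ a, binBregman n (f a) (p a) (q a)
  have hm0 : 0 < m := hD.trans_le hm
  have h := one_sub_le_prodE_of_variance hp hp1 (t := m / 4) (by positivity)
    ((variance_testStat_le (f := f) (q := q) hp hp1).trans hV)
    (fun x => D / 2 ≤ testStat f q n (counts x) - 2 * r) fun x hx => by
      rw [hmean, abs_lt] at hx
      linarith [hx.1]
  refine le_trans (le_of_eq ?_) h
  field_simp
  norm_num

end statistic

end Statistic

/-! ### Robust statistics for nearly uniform `q`, in the regimes `n ≤ k` and `k ≤ n`. -/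

section RobustStatistic

open Finset

section existence

variable {A : Type*} [Fintype A] [DecidableEq A] {k n : ℕ} {γ α : ℝ} {q : A → ℝ}

/-- `Φ` tests identity to `q`, with the threshold `θ`, even if it is observed with an error `2 r`. -/
structure IsRobustStatistic (q : A → ℝ) (α r : ℝ) (Φ : (Fin n → A) → ℝ) (θ : ℝ) : Prop where
  lipschitz : ∀ x x', |Φ x - Φ x'| ≤ 2 * hammingDist x x'
  accept : 15 / 16 ≤ prodE q n fun x => if Φ x + 2 * r < θ then 1 else 0
  reject : ∀ p : A → ℝ, (∀ a, 0 ≤ p a) → ∑ a, p a = 1 → 2 * α ≤ ∑ a, |p a - q a| →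
    15 / 16 ≤ prodE p n fun x => if θ ≤ Φ x - 2 * r then 1 else 0

theorem isRobustStatistic_collisions (hk : 2 ≤ k) (hnk : n ≤ k) (hα : 0 < α)
    (hα1 : α ≤ 1) (hcard : Fintype.card A ≤ 3 * k) (hq : ∀ a, 0 ≤ q a) (hq1 : ∑ a, q a = 1)
    (hqk : ∀ a, q a ≤ 1 / (2 * k)) (h1 : 4096 ^ 4 * (k : ℝ) ≤ n ^ 2 * α ^ 4)
    (h3 : 4096 ^ 2 * (k * γ) ≤ n * α ^ 2) :
    ∃ (Φ : (Fin n → A) → ℝ) (θ : ℝ), IsRobustStatistic q α (γ * n) Φ θ := by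
  have hk' : (2 : ℝ) ≤ k := by exact_mod_cast hk
  have hnk' : (n : ℝ) ≤ k := by exact_mod_cast hnk
  have hn0 : (0 : ℝ) ≤ n := by positivity
  have hα4 : α ^ 4 ≤ 1 := pow_le_one₀ hα.le hα1
  have hα42 : α ^ 4 ≤ α ^ 2 := pow_le_pow_of_le_one hα.le hα1 (by norm_num)
  have hn2 : 2 ≤ n := by
    by_contra hcon
    have : (n : ℝ) ≤ 1 := by exact_mod_cast (by omega : n ≤ 1)
    nlinarith
  have hn2' : (2 : ℝ) ≤ n := by exact_mod_cast hn2
  -- The value `t n α / 160` from `sum_bregman_ge` with `l = 1` and `t = 2 n α / (3 k)`.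
  set D : ℝ := n ^ 2 * α ^ 2 / (240 * k) with hD
  have hDpos : 0 < D := by positivity
  -- This absorbs the part `2 m` of the variance at mean `m ≥ D`, since then `2 m ≤ m² / 512`.
  have hD1 : 1024 ≤ D := by
    rw [hD, le_div_iff₀ (by positivity)]
    nlinarith
  have hD2 : 512 * (n ^ 2 * (1 / (k : ℝ)) * (5 / 2)) ≤ D ^ 2 := by
    have e : D ^ 2 = n ^ 2 * (1 / k) * (n ^ 2 * α ^ 4 / (57600 * k)) := by
      rw [hD]
      field_simp
      norm_num
    rw [e, mul_comm (512 : ℝ), mul_assoc]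
    refine mul_le_mul_of_nonneg_left ?_ (by positivity)
    rw [le_div_iff₀ (by positivity)]
    nlinarith
  have hmain : ∀ {p : A → ℝ}, (∀ a, 0 ≤ p a) → ∑ a, p a = 1 →
      statVariance (fun _ => collisions) q n p ≤
        2 * ∑ a, binBregman n collisions (p a) (q a) + D ^ 2 / 512 := by
    intro p hp hp1
    have hb : (n : ℝ) * (1 / (2 * k)) ≤ 1 := by
      rw [mul_one_div, div_le_one (by positivity)]
      linarith
    have := statVariance_collisions_le hb hq hqk hq1 hp hp1
    have e : 5 * (n : ℝ) ^ 2 * (1 / (2 * k)) = n ^ 2 * (1 / (k : ℝ)) * (5 / 2) := by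
      field_simp
    rw [e] at this
    linarith
  have hr : 2 * (γ * n) ≤ D / 4 := by
    rw [hD, div_div, le_div_iff₀ (by positivity)]
    nlinarith
  refine ⟨fun x => testStat (fun _ => collisions) q n (counts x), D / 2,
    abs_testStat_counts_sub_le (fun _ j => ?_) (fun _ j => ?_) hq hq1,
    accept_prob_ge hq hq1 hDpos hr ?_, fun p hp hp1 hpα => ?_⟩
  · rw [collisions_diff]; split_ifs <;> norm_num
  · rw [collisions_diff]; split_ifs <;> norm_num
  · have := hmain hq hq1
    simp only [binBregman, sub_self, mul_zero, sum_const_zero] at this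
    nlinarith
  · have hm : D ≤ ∑ a, binBregman n collisions (p a) (q a) := by
      have ht1 : 2 * (n * α) / (3 * k) ≤ 1 := by
        rw [div_le_one (by positivity)]
        nlinarith
      refine le_trans (le_of_eq ?_) (sum_bregman_ge hcard (hp1.trans hq1.symm) hn0 one_pos
        (t := 2 * (n * α) / (3 * k)) (by positivity) ht1 (le_of_eq ?_) (fun a => ?_)
        (fun a ha => ?_) hpα)
      · rw [hD]
        field_simp
        norm_num
      · field_simp
      · exact binBregman_nonneg n (fun j => by rw [collisions_diff_diff]; split_ifs <;> norm_num)
          (hp a) (le_one_of_sum_eq_one hp hp1 a) (hq a) (le_one_of_sum_eq_one hq hq1 a)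
      · have hqa : n * q a ≤ 1 / 2 := by
          refine (mul_le_mul_of_nonneg_left (hqk a) hn0).trans ?_
          rw [mul_one_div, div_le_iff₀ (by positivity)]
          linarith
        refine le_trans ?_ (binBregman_collisions_ge hn2 (hp a) ha hqa)
        refine (mul_le_mul_of_nonneg_left (min_le_left _ _) (by norm_num)).trans ?_
        linarith [sq_nonneg (n * (q a - p a))]
    refine reject_prob_ge hp hp1 hDpos hr hm ((hmain hp hp1).trans ?_)
    nlinarith

theorem isRobustStatistic_smoothHinge (hk : 2 ≤ k) (hnk : k ≤ n) (hα : 0 < α)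
    (hα1 : α ≤ 1) (hcard : Fintype.card A ≤ 3 * k) (hq : ∀ a, 0 ≤ q a) (hq1 : ∑ a, q a = 1)
    (hqk : ∀ a, q a ≤ 1 / (2 * k)) (h1 : 4096 ^ 4 * (k : ℝ) ≤ n ^ 2 * α ^ 4)
    (h2 : 4096 * γ ≤ α) (h4 : 4096 ^ 4 * (k * γ ^ 2) ≤ n * α ^ 4) :
    ∃ (Φ : (Fin n → A) → ℝ) (θ : ℝ), IsRobustStatistic q α (γ * n) Φ θ := by
  have hk' : (2 : ℝ) ≤ k := by exact_mod_cast hk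
  have hnk' : (k : ℝ) ≤ n := by exact_mod_cast hnk
  have hn2 : 2 ≤ n := hk.trans hnk
  have hn2' : (2 : ℝ) ≤ n := by exact_mod_cast hn2
  have hα42 : α ^ 4 ≤ α ^ 2 := pow_le_pow_of_le_one hα.le hα1 (by norm_num)
  -- The scale of the standard deviation of a count in a cell of probability about `1 / k`.
  set l : ℝ := √(n / k) with hl
  have hl2 : l ^ 2 = n / k := Real.sq_sqrt (by positivity)
  have hl1 : 1 ≤ l := by
    rw [hl, Real.one_le_sqrt, one_le_div (by positivity)]
    exact hnk'
  -- The largest `t` that `sum_bregman_ge` allows. If it is `1`, the linear regime of the hinge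
  -- prevails and `γ ≲ α` bounds the corruption; otherwise the quadratic one does, with `k γ² ≲ n
  -- α⁴`.
  set t : ℝ := min 1 (2 * (n * α) / (3 * k * l)) with ht
  have ht0 : 0 < t := lt_min one_pos (by positivity)
  have htl : t * (3 * k * l) ≤ 2 * (n * α) := by
    have := min_le_right (1 : ℝ) (2 * (n * α) / (3 * k * l))
    rwa [le_div_iff₀ (by positivity)] at this
  set D : ℝ := t * (n * α) / 160 with hD
  have hDpos : 0 < D := by positivity
  have hDn : n ≤ D ^ 2 / 256 := by
    rcases min_cases (1 : ℝ) (2 * (n * α) / (3 * k * l)) with ⟨e, -⟩ | ⟨e, -⟩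
    · rw [hD, ht, e]
      have : 4096 ^ 2 ≤ n * α ^ 2 := by
        have h5 : (4096 : ℝ) ^ 2 * 4096 ^ 2 ≤ n * α ^ 2 * (n * α ^ 2) := by nlinarith
        nlinarith [show 0 ≤ n * α ^ 2 by positivity]
      nlinarith
    · have e2 : D ^ 2 / 256 = n * (n ^ 2 * α ^ 4 / (57600 * 256 * k)) := by
        rw [hD, ht, e]
        have : D = n ^ 2 * α ^ 2 / (240 * k * l) := by
          rw [hD, ht, e]
          field_simp
          norm_num
        rw [hD, ht, e] at this
        rw [this, div_pow, mul_pow _ l, hl2]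
        field_simp
        norm_num
      rw [e2]
      refine le_mul_of_one_le_right (by positivity) ?_
      rw [one_le_div (by positivity)]
      nlinarith
  have hr : 2 * (γ * n) ≤ D / 4 := by
    suffices h : 1280 * γ ≤ t * α by
      rw [hD]
      nlinarith [mul_le_mul_of_nonneg_right h (show (0 : ℝ) ≤ n by positivity)]
    rcases min_cases (1 : ℝ) (2 * (n * α) / (3 * k * l)) with ⟨e, -⟩ | ⟨e, -⟩
    · rw [ht, e]
      linarith
    · rw [ht, e]
      refine le_of_sq_le_sq ?_ (by positivity)
      have e2 : (2 * (n * α) / (3 * k * l) * α) ^ 2 = 4 / 9 * (n * α ^ 4 / k) := by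
        have : 2 * (n * α) / (3 * k * l) * α = 2 * (n * α ^ 2) / (3 * k) / l := by field_simp
        rw [this, div_pow _ l, hl2]
        field_simp
        norm_num
      rw [e2]
      have h5 : 4096 ^ 4 * γ ^ 2 ≤ n * α ^ 4 / k := by
        rw [le_div_iff₀ (by positivity)]
        linarith
      nlinarith [sq_nonneg γ]
  set f : A → ℕ → ℝ := fun a => smoothHinge (n * q a - 6 * l) (12 * l)
  have hf0 : ∀ a j, 0 ≤ f a (j + 1) - f a j := fun a j => by
    rw [smoothHinge_diff]
    exact ramp_nonneg _ _ _
  have hf1 : ∀ a j, f a (j + 1) - f a j ≤ 1 := fun a j => by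
    rw [smoothHinge_diff]
    exact ramp_le_one _ _ _
  refine ⟨fun x => testStat f q n (counts x), D / 2, abs_testStat_counts_sub_le hf0 hf1 hq hq1,
    accept_prob_ge hq hq1 hDpos hr ((statVariance_le hf0 hf1 hq hq1 hq hq1).trans hDn),
    fun p hp hp1 hpα => ?_⟩
  have hm : D ≤ ∑ a, binBregman n (f a) (p a) (q a) := by
    refine sum_bregman_ge hcard (hp1.trans hq1.symm) (by positivity) (by positivity) ht0.le
      (min_le_left _ _) htl (fun a => ?_) (fun a ha => ?_) hpα
    · refine binBregman_nonneg n (fun j => ?_) (hp a) (le_one_of_sum_eq_one hp hp1 a) (hq a)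
        (le_one_of_sum_eq_one hq hq1 a)
      have e1 : f a (j + 1 + 1) - f a (j + 1) = _ := smoothHinge_diff _ _ _
      have e2 : f a (j + 1) - f a j = _ := smoothHinge_diff _ _ _
      rw [show j + 2 = j + 1 + 1 by ring, e1, e2]
      exact sub_nonneg.2 (ramp_mono _ (by positivity) j)
    · refine binBregman_smoothHinge_ge hn2 (hp a) ha (le_one_of_sum_eq_one hq hq1 a) hl1 ?_
      rw [hl2]
      refine (mul_le_mul_of_nonneg_left (hqk a) (by positivity)).trans (le_of_eq ?_)
      field_simp
  refine reject_prob_ge hp hp1 hDpos hr hm ((statVariance_le hf0 hf1 hq hq1 hp hp1).trans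
    (hDn.trans ?_))
  gcongr

end existence

end RobustStatistic

/-! ### Splitting letters with the public coin, and the resulting scheme. -/

section UpperBound

open Finset MeasureTheory

variable {k n : ℕ}

theorem sum_toReal (p : PMF (Fin k)) : ∑ x, (p x).toReal = 1 := by
  have h := p.tsum_coe
  rw [tsum_fintype] at h
  rw [← ENNReal.toReal_sum fun x _ => p.apply_ne_top x, h, ENNReal.toReal_one]

theorem dTV_le_one (p q : PMF (Fin k)) : dTV p q ≤ 1 := by
  have : ∑ x, |(p x).toReal - (q x).toReal| ≤ ∑ x, ((p x).toReal + (q x).toReal) :=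
    sum_le_sum fun x _ => by
      have h1 : 0 ≤ (p x).toReal := ENNReal.toReal_nonneg
      have h2 : 0 ≤ (q x).toReal := ENNReal.toReal_nonneg
      rw [abs_le]
      constructor <;> linarith
  rw [sum_add_distrib, sum_toReal, sum_toReal] at this
  unfold dTV
  linarith

section flatten

/-- The number of copies into which the letter `x` is split, so that each copy has probability at
most `1 / (2 k)` under `q`. -/
def copies (q : PMF (Fin k)) (x : Fin k) : ℕ := ⌊2 * k * (q x).toReal⌋₊ + 1

/-- The alphabet of the copies of the letters. -/
abbrev Flat (q : PMF (Fin k)) : Type := Σ x : Fin k, Fin (copies q x)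

/-- The distribution of a uniform copy of a letter that has the distribution `p`. -/
def flatten (q p : PMF (Fin k)) (a : Flat q) : ℝ := (p a.1).toReal / copies q a.1

variable (q p : PMF (Fin k))

theorem copies_pos (x : Fin k) : (0 : ℝ) < copies q x := by
  unfold copies
  positivity

theorem flatten_nonneg (a : Flat q) : 0 ≤ flatten q p a :=
  div_nonneg ENNReal.toReal_nonneg (copies_pos q _).le

theorem sum_flatten : ∑ a, flatten q p a = 1 := by
  rw [Fintype.sum_sigma, ← sum_toReal p]
  refine sum_congr rfl fun x _ => ?_
  have := copies_pos q x
  simp [flatten]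
  field_simp

theorem sum_abs_flatten_sub : ∑ a, |flatten q p a - flatten q q a| = 2 * dTV p q := by
  rw [Fintype.sum_sigma, dTV, ← mul_assoc, show (2 : ℝ) * (1 / 2) = 1 by norm_num, one_mul]
  refine sum_congr rfl fun x _ => ?_
  have := copies_pos q x
  simp only [flatten, ← sub_div, abs_div, abs_of_pos this, sum_const, card_univ, Fintype.card_fin,
    nsmul_eq_mul]
  field_simp

theorem flatten_self_le (hk : 2 ≤ k) (a : Flat q) : flatten q q a ≤ 1 / (2 * k) := by
  have hk' : (2 : ℝ) ≤ k := by exact_mod_cast hk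
  unfold flatten
  rw [div_le_div_iff₀ (copies_pos q _) (by positivity)]
  have := (Nat.lt_floor_add_one (2 * k * (q a.1).toReal)).le
  unfold copies
  push_cast
  linarith

theorem card_flat_le : Fintype.card (Flat q) ≤ 3 * k := by
  have h : (Fintype.card (Flat q) : ℝ) ≤ 3 * k := by
    simp only [Fintype.card_sigma, Fintype.card_fin]
    simp only [copies]
    push_cast
    calc ∑ x, ((⌊2 * k * (q x).toReal⌋₊ : ℝ) + 1) ≤ ∑ x, (2 * k * (q x).toReal + 1) :=
          sum_le_sum fun x _ => add_le_add
            (Nat.floor_le (mul_nonneg (by positivity) ENNReal.toReal_nonneg)) le_rfl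
      _ = 3 * k := by
          rw [sum_add_distrib, ← mul_sum, sum_toReal]
          simp
          ring
  exact_mod_cast h

/-- The coin fixes in advance, for every user and every letter, which copy is taken. Averaged over
the coin, the relabelled samples are independent draws from the flattened distribution. -/
theorem prodE_flatten (n : ℕ) (F : (Fin n → Flat q) → ℝ) :
    prodE (flatten q p) n F =
      (Fintype.card (Fin n → ∀ x, Fin (copies q x)) : ℝ)⁻¹ *
        ∑ u : Fin n → ∀ x, Fin (copies q x),
          prodE (fun x => (p x).toReal) n fun x => F fun i => ⟨x i, u i (x i)⟩ := by
  classical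
  set R := ∀ x, Fin (copies q x)
  have hflat : flatten q p = fun b => ∑ a : R × Fin k with (⟨a.2, a.1 a.2⟩ : Flat q) = b,
      (Fintype.card R : ℝ)⁻¹ * (p a.2).toReal := by
    funext ⟨y, l⟩
    have hcount : ∑ r : R, (if r y = l then (1 : ℝ) else 0) =
        Fintype.card R / copies q y := by
      have h1 := Fintype.card_filter_piFinset_eq_of_mem (fun x => (univ : Finset (Fin (copies q x))))
        y (mem_univ l)
      rw [Fintype.piFinset_univ] at h1
      rw [sum_boole, h1]
      have h2 : Fintype.card R = copies q y * ∏ x ∈ univ.erase y, copies q x := by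
        rw [mul_prod_erase _ _ (mem_univ y)]
        simp [R]
      have := copies_pos q y
      rw [h2]
      push_cast
      field_simp
      simp
    rw [sum_filter, Fintype.sum_prod_type]
    have h3 : ∀ r : R, ∑ x, (if (⟨x, r x⟩ : Flat q) = ⟨y, l⟩ then
        (Fintype.card R : ℝ)⁻¹ * (p x).toReal else 0) =
        (Fintype.card R : ℝ)⁻¹ * (p y).toReal * if r y = l then 1 else 0 := by
      intro r
      rw [sum_eq_single y]
      · simp
      · intro x _ hx
        rw [if_neg]
        intro h
        exact hx (congrArg Sigma.fst h)
      · simp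
    have hR : (Fintype.card R : ℝ) ≠ 0 := by
      have : Nonempty R := ⟨fun x => ⟨0, Nat.succ_pos _⟩⟩
      exact_mod_cast Fintype.card_ne_zero
    rw [sum_congr rfl fun r _ => h3 r, ← mul_sum, hcount, flatten]
    field_simp
  rw [hflat, prodE_map, prodE, ← (Equiv.arrowProdEquivProdArrow (Fin n) (fun _ => R)
    (fun _ => Fin k)).symm.sum_comp, Fintype.sum_prod_type, mul_sum]
  refine sum_congr rfl fun u _ => ?_
  rw [prodE, mul_sum]
  refine sum_congr rfl fun x _ => ?_
  simp only [Equiv.arrowProdEquivProdArrow, Equiv.coe_fn_symm_mk, prod_mul_distrib, prod_const,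
    card_univ, Fintype.card_fin, Fintype.card_fun]
  push_cast
  rw [inv_pow]
  ring

end flatten

section rawScheme

variable {𝒴 : Type} {𝒲 : Set (Channel k 𝒴)}

/-- The scheme in which the users send their samples as they are and the public coin, which only the
tester uses, is uniform on a finite type. -/
def rawScheme (n : ℕ) (e : Fin k → 𝒴) (he : (fun x => PMF.pure (e x)) ∈ 𝒲) (Ω : Type) [Fintype Ω]
    [Nonempty Ω] (T : Ω → (Fin n → 𝒴) → Bool) : Scheme k n 𝒲 where
  Ω := Ω
  mΩ := ⊤
  μ := @PMF.toMeasure Ω ⊤ (PMF.uniformOfFintype Ω)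
  isProb := @PMF.toMeasure.isProbabilityMeasure Ω ⊤ (PMF.uniformOfFintype Ω)
  W := fun _ _ x => PMF.pure (e x)
  W_mem := fun _ _ => he
  measurable_W := fun _ _ _ => measurable_const
  T := T
  measurable_T := fun _ => trivial

theorem le_answerProb_rawScheme (e : Fin k ↪ 𝒴) (he : (fun x => PMF.pure (e x)) ∈ 𝒲)
    (Ω : Type) [Fintype Ω] [Nonempty Ω] (T : Ω → (Fin n → 𝒴) → Bool)
    (M : Ω → (Fin n → 𝒴) → (Fin n → 𝒴)) (p : PMF (Fin k)) (b : Bool)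
    (G : Ω → (Fin n → Fin k) → Prop) [∀ u, DecidablePred (G u)]
    (hG : ∀ u x, G u x → T u (M u fun i => e (x i)) = b) :
    ENNReal.ofReal ((Fintype.card Ω : ℝ)⁻¹ *
      ∑ u, prodE (fun x => (p x).toReal) n fun x => if G u x then 1 else 0) ≤
      (rawScheme n e he Ω T).answerProb M p b := by
  let _ : MeasurableSpace Ω := ⊤
  have _ : DiscreteMeasurableSpace Ω := ⟨fun _ => trivial⟩
  have hcard : (0 : ℝ) < Fintype.card Ω := by exact_mod_cast Fintype.card_pos
  have h1 : (rawScheme n e he Ω T).answerProb M p b =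
      ∫⁻ u, ∑' y : Fin n → 𝒴, (if T u (M u y) = b then
        messageProb p (fun _ x => PMF.pure (e x)) y else 0) ∂(PMF.uniformOfFintype Ω).toMeasure :=
    rfl
  have h2 : ∀ u, ENNReal.ofReal (prodE (fun x => (p x).toReal) n
      fun x => if G u x then 1 else 0) ≤ ∑' y : Fin n → 𝒴, (if T u (M u y) = b then
        messageProb p (fun _ x => PMF.pure (e x)) y else 0) := by
    intro u
    have hinj : Function.Injective fun (x : Fin n → Fin k) i => e (x i) := fun x x' h =>
      funext fun i => e.injective (congrFun h i)
    refine le_trans ?_ (ENNReal.tsum_comp_le_tsum_of_injective hinj _)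
    rw [tsum_fintype, ofReal_prodE_toReal _ _ fun x => by split_ifs <;> norm_num]
    refine sum_le_sum fun x _ => ?_
    by_cases h : G u x
    · rw [if_pos (hG u x h), if_pos h, ENNReal.ofReal_one, mul_one, messageProb]
      refine le_of_eq (prod_congr rfl fun i _ => ?_)
      simp [PMF.pure_apply]
    · simp [h]
  rw [h1, lintegral_fintype, mul_sum, ENNReal.ofReal_sum_of_nonneg]
  · refine sum_le_sum fun u _ => ?_
    rw [PMF.toMeasure_apply_singleton _ _ (measurableSet_singleton _),
      PMF.uniformOfFintype_apply, mul_comm, ENNReal.ofReal_mul' (by positivity),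
      ENNReal.ofReal_inv_of_pos hcard, ENNReal.ofReal_natCast]
    exact mul_le_mul_left (h2 u) _
  · intro u _
    exact mul_nonneg (by positivity) (prodE_nonneg (fun _ => ENNReal.toReal_nonneg) fun x => by
      split_ifs <;> norm_num)

theorem nine_tenths_lt_ofReal {x : ℝ} (h : 15 / 16 ≤ x) : 9 / 10 < ENNReal.ofReal x := by
  have : (9 / 10 : ℝ≥0∞) = ENNReal.ofReal (9 / 10) := by
    rw [ENNReal.ofReal_div_of_pos (by norm_num)]
    norm_num
  rw [this, ENNReal.ofReal_lt_ofReal_iff (by linarith)]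
  linarith

theorem exists_tests_of_one_lt (h𝒲 : AllowsRawSamples 𝒲) (n : ℕ) (γ : ℝ) {α : ℝ} (hα : 1 < α)
    (q : PMF (Fin k)) : ∃ S : Scheme k n 𝒲, S.Tests γ α q := by
  obtain ⟨e, he⟩ := h𝒲
  refine ⟨rawScheme n e he Unit fun _ _ => true, fun M _ => ⟨?_, fun p hp => ?_⟩⟩
  · refine (nine_tenths_lt_ofReal ?_).trans_le
      (le_answerProb_rawScheme e he Unit (fun _ _ => true) M q true (fun _ _ => True) fun _ _ _ => rfl)
    simp only [if_true, prodE_const (sum_toReal q)]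
    norm_num
  · linarith [dTV_le_one p q]

/-- The relabelling acts on each coordinate separately, so an adversary who knows the coin still
changes at most `γ n` relabelled samples and moves `Φ` by at most `2 γ n`. Messages outside the
image of the encoding are decoded arbitrarily; only attacks produce them. -/
theorem exists_tests_of_isRobustStatistic (hk : 2 ≤ k) (h𝒲 : AllowsRawSamples 𝒲) {γ α θ : ℝ}
    {q : PMF (Fin k)} {Φ : (Fin n → Flat q) → ℝ}
    (hΦ : IsRobustStatistic (flatten q q) α (γ * n) Φ θ) :
    ∃ S : Scheme k n 𝒲, S.Tests γ α q := by
  classical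
  obtain ⟨e, he⟩ := h𝒲
  have : Nonempty (Fin k) := ⟨⟨0, by omega⟩⟩
  have : Nonempty (Fin n → ∀ x, Fin (copies q x)) := ⟨fun _ x => ⟨0, Nat.succ_pos _⟩⟩
  set δ : (Fin n → ∀ x, Fin (copies q x)) → (Fin n → 𝒴) → Fin n → Flat q := fun u z i =>
    ⟨Function.invFun e (z i), u i (Function.invFun e (z i))⟩ with hδ
  have hδe : ∀ u (x : Fin n → Fin k), δ u (fun i => e (x i)) = fun i => ⟨x i, u i (x i)⟩ := by
    intro u x
    funext i
    have h := Function.leftInverse_invFun e.injective (x i)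
    simp only [hδ]
    rw [h]
  refine ⟨rawScheme n e he (Fin n → ∀ x, Fin (copies q x))
    fun u z => decide (Φ (δ u z) < θ), fun M hM => ?_⟩
  have hclose : ∀ (u : Fin n → ∀ x, Fin (copies q x)) (x : Fin n → Fin k),
      |Φ (δ u (M u fun i => e (x i))) - Φ fun i => ⟨x i, u i (x i)⟩| ≤ 2 * (γ * n) := by
    intro u x
    rw [← hδe]
    refine (hΦ.lipschitz _ _).trans (mul_le_mul_of_nonneg_left (le_trans ?_ (hM.1 u fun i => e (x i)))
      (by norm_num))
    exact_mod_cast hammingDist_map_le (fun i (y : 𝒴) =>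
      (⟨Function.invFun e y, u i (Function.invFun e y)⟩ : Flat q)) _ _
  constructor
  · refine (nine_tenths_lt_ofReal ?_).trans_le (le_answerProb_rawScheme e he
      (Fin n → ∀ x, Fin (copies q x)) _ M q true (fun u x =>
        Φ (fun i => ⟨x i, u i (x i)⟩) + 2 * (γ * n) < θ) fun u x h => ?_)
    · rw [← prodE_flatten q q n fun y => if Φ y + 2 * (γ * n) < θ then 1 else 0]
      exact hΦ.accept
    · have := abs_le.1 (hclose u x)
      exact decide_eq_true (by linarith)
  · intro p hp
    refine (nine_tenths_lt_ofReal ?_).trans_le (le_answerProb_rawScheme e he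
      (Fin n → ∀ x, Fin (copies q x)) _ M p false (fun u x =>
        θ ≤ Φ (fun i => ⟨x i, u i (x i)⟩) - 2 * (γ * n)) fun u x h => ?_)
    · rw [← prodE_flatten q p n fun y => if θ ≤ Φ y - 2 * (γ * n) then 1 else 0]
      refine hΦ.reject _ (flatten_nonneg q p) (sum_flatten q p) ?_
      rw [sum_abs_flatten_sub]
      linarith
    · have := abs_le.1 (hclose u x)
      exact decide_eq_false (by linarith)

theorem exists_tests_of_rate_le (hk : 2 ≤ k) (hn : 1 ≤ n) {γ α : ℝ} (hγ : 0 ≤ γ) (hα : 0 < α)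
    (hα1 : α ≤ 1) (h𝒲 : AllowsRawSamples 𝒲)
    (h : 4096 * ((k : ℝ) ^ (1 / 4 : ℝ) / √(n : ℝ) + γ + √(k * γ / n) +
      (k * γ ^ 2 / n) ^ (1 / 4 : ℝ)) ≤ α) (q : PMF (Fin k)) :
    ∃ S : Scheme k n 𝒲, S.Tests γ α q := by
  have hn' : (0 : ℝ) < n := by exact_mod_cast hn
  have hquarter : ∀ {x : ℝ}, 0 ≤ x → (x ^ (1 / 4 : ℝ)) ^ 4 = x := fun {x} hx => by
    rw [← Real.rpow_natCast, ← Real.rpow_mul hx]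
    norm_num
  have p1 : 0 ≤ (k : ℝ) ^ (1 / 4 : ℝ) / √(n : ℝ) := by positivity
  have p3 : 0 ≤ √(k * γ / n) := by positivity
  have p4 : 0 ≤ (k * γ ^ 2 / n) ^ (1 / 4 : ℝ) := by positivity
  have h1 : 4096 ^ 4 * (k : ℝ) ≤ n ^ 2 * α ^ 4 := by
    have := pow_le_pow_left₀ (by positivity)
      (show 4096 * ((k : ℝ) ^ (1 / 4 : ℝ) / √(n : ℝ)) ≤ α by linarith) 4
    rw [mul_pow, div_pow, hquarter (by positivity),
      show √(n : ℝ) ^ 4 = (√(n : ℝ) ^ 2) ^ 2 by ring, Real.sq_sqrt hn'.le, ← mul_div_assoc,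
      div_le_iff₀ (by positivity)] at this
    linarith
  have h2 : 4096 * γ ≤ α := by linarith
  have h3 : 4096 ^ 2 * (k * γ) ≤ n * α ^ 2 := by
    have := pow_le_pow_left₀ (by positivity) (show 4096 * √(k * γ / n) ≤ α by linarith) 2
    rw [mul_pow, Real.sq_sqrt (by positivity), ← mul_div_assoc, div_le_iff₀ hn'] at this
    linarith
  have h4 : 4096 ^ 4 * (k * γ ^ 2) ≤ n * α ^ 4 := by
    have := pow_le_pow_left₀ (by positivity)
      (show 4096 * (k * γ ^ 2 / n) ^ (1 / 4 : ℝ) ≤ α by linarith) 4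
    rw [mul_pow, hquarter (by positivity), ← mul_div_assoc, div_le_iff₀ hn'] at this
    linarith
  rcases le_total n k with hnk | hnk
  · obtain ⟨Φ, θ, hΦ⟩ := isRobustStatistic_collisions hk hnk hα hα1 (card_flat_le q)
      (flatten_nonneg q q) (sum_flatten q q) (flatten_self_le q hk) h1 h3
    exact exists_tests_of_isRobustStatistic hk h𝒲 hΦ
  · obtain ⟨Φ, θ, hΦ⟩ := isRobustStatistic_smoothHinge hk hnk hα hα1 (card_flat_le q)
      (flatten_nonneg q q) (sum_flatten q q) (flatten_self_le q hk) h1 h2 h4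
    exact exists_tests_of_isRobustStatistic hk h𝒲 hΦ

end rawScheme

end UpperBound

end RobustTesting

end

/-! ### The two-sided bound on the risk. -/

theorem theorem5 :
    ∃ c C : ℝ, 0 < c ∧ 0 < C ∧
      ∀ (k n : ℕ) (γ : ℝ), 2 ≤ k → 1 ≤ n → 0 ≤ γ → γ ≤ 1 →
        ∀ (𝒴 : Type) [Countable 𝒴] (𝒲 : Set (RobustTesting.Channel k 𝒴)),
          RobustTesting.AllowsRawSamples 𝒲 →
            c * RobustTesting.rateIT k n γ ≤ RobustTesting.riskIT k n 𝒲 γ ∧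
              RobustTesting.riskIT k n 𝒲 γ ≤ C * RobustTesting.rateIT k n γ := by
  refine ⟨1 / 32, 4096, by norm_num, by norm_num, fun k n γ hk hn hγ _ 𝒴 _ 𝒲 h𝒲 => ⟨?_, ?_⟩⟩
  · refine le_csInf ⟨2, by norm_num, fun q =>
      RobustTesting.exists_tests_of_one_lt h𝒲 n γ (by norm_num) q⟩ ?_
    rintro α ⟨hα, hS⟩
    exact RobustTesting.rateIT_le_of_tests hk hn hγ hα hS
  · have hk' : (0 : ℝ) < k := by exact_mod_cast (by omega : 0 < k)
    have hn' : (0 : ℝ) < n := by exact_mod_cast hn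
    have hpos : 0 < RobustTesting.rateIT k n γ := lt_min one_pos (by positivity)
    refine csInf_le ⟨0, fun α hα => hα.1.le⟩ ⟨by positivity, fun q => ?_⟩
    -- Beyond distance `1` there is no alternative to detect. Otherwise the rate is below its cap,
    -- so the minimum is the sum of the four terms.
    by_cases h1 : 1 < 4096 * RobustTesting.rateIT k n γ
    · exact RobustTesting.exists_tests_of_one_lt h𝒲 n γ h1 q
    · push Not at h1
      refine RobustTesting.exists_tests_of_rate_le hk hn hγ (by positivity) h1 h𝒲 ?_ q
      refine mul_le_mul_of_nonneg_left (le_of_eq ?_) (by norm_num)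
      refine (min_eq_right ?_).symm
      by_contra hcon
      push Not at hcon
      have : RobustTesting.rateIT k n γ = 1 := min_eq_left hcon.le
      linarith
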